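/- For each integer $k\ge 2$ and each real $\alpha>0$ there is some $\eta>0$, depending only on $k$ and $\alpha$, such that the following holds. For every $\varepsilon>0$ there is $N$ such that for every $n\ge N$ and every graph $G_\alpha$ on the vertex set $[n]=\{1,\dots,n\}$ with minimum degree at least $\alpha n$, $$\mathbb{P}\bigl[\,G_\alpha\cup G(n,n^{-1/k-\eta})\text{ contains the }k\text{th power of a Hamilton cycle}\,\bigr]\ge 1-\varepsilon .$$ That is, $G_\alpha\cup G(n,n^{-1/k-\eta})$ contains the $k$th power of a Hamilton cycle with high probability, uniformly over the choice of $G_\alpha$. Here $n^{-1/k-\eta}$ denotes $n^{-(1/k)-\eta}$; $G(n,p)$ is the binomial random graph on $[n]$, in which each possible edge is present independently with probability $p$; and a graph on $n$ vertices contains the $k$th power of a Hamilton cycle if it has a (not necessarily induced) subgraph isomorphic to the graph obtained from the cycle on $n$ vertices by joining every two distinct vertices at distance at most $k$. -/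

import Mathlib

namespace PerturbedGraph

/-- The `k`th power of a graph `G`: distinct vertices are joined when their distance in `G`
is at most `k` (the distance between vertices of different components is `⊤`). -/
def graphPower {V : Type*} (G : SimpleGraph V) (k : ℕ) : SimpleGraph V where
  Adj u v := u ≠ v ∧ G.edist u v ≤ k
  symm := ⟨fun _ _ h => ⟨h.1.symm, by rw [SimpleGraph.edist_comm]; exact h.2⟩⟩
  loopless := ⟨fun _ h => h.1 rfl⟩

/-- A graph on `n` vertices contains the `k`th power of a Hamilton cycle: it contains, as a
not necessarily induced (and then automatically spanning) subgraph, a copy of the `k`th power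
of the cycle with `n` vertices. -/
def ContainsHamiltonCyclePower {n : ℕ} (G : SimpleGraph (Fin n)) (k : ℕ) : Prop :=
  (graphPower (SimpleGraph.cycleGraph n) k).IsContained G

/-- The edge probability `n ^ (-1/k - η)`, an element of `[0, 1]`
(with value `0` in the degenerate case `n = 0`). -/
noncomputable def edgeProb (k : ℕ) (η : ℝ) (hη : 0 < η) (n : ℕ) : unitInterval :=
  ⟨(n : ℝ) ^ (-1 / (k : ℝ) - η), by
    have hx : -1 / (k : ℝ) - η < 0 := by
      have : -1 / (k : ℝ) ≤ 0 := div_nonpos_of_nonpos_of_nonneg (by norm_num) (by positivity)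
      linarith
    refine ⟨by positivity, ?_⟩
    rcases Nat.eq_zero_or_pos n with rfl | hn
    · simp [Real.zero_rpow hx.ne]
    · exact Real.rpow_le_one_of_one_le_of_nonpos (by exact_mod_cast hn) hx.le⟩

end PerturbedGraph

/-! Index the positions of the cycle by `ZMod n` and mark one centre in each of `n / L` consecutive
blocks of a large constant length `L`. Fixed vertices go to the centres, and neighbours of each
fixed vertex in `G` go to the `2 * k` positions around its centre; the minimum degree leaves
linearly many choices for every such position. All edges of the cycle power at centres then lie in
`G`, and only the remaining edges, those of `cyclePowerOff`, have to come from the random graph.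

The gain is in density. The full power has about `k` edges per vertex, but without the edges at
centres every nonempty vertex set `W` spans at most `κ * (#W - 1)` edges for a constant `κ < k`
(`sum_forwardDegree_le`).

Choose the arrangement at random. Prescribing the vertices at `d` non-central positions has
probability at most `(c / n) ^ d` (`exists_spread_weights`). Combined with the density bound and a
count of homomorphisms, this shows that the placed edges contain a given set `I` with probability at
most `q ^ #I`, where `q` has order `n ^ (-1/κ)` (`sum_placedEdges_le`).

Since `1/κ > 1/k`, the edge probability exceeds `q` by a fixed power of `n` once `η` is small. The
minimum-fragment argument for spread measures (`spread_mul_subsetExp_le`) then needs only a bounded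
number of rounds: each divides the number of missing edges by a small power `z` of `n` and costs
failure probability `e / z`. -/

open Finset

namespace PerturbedGraph

/-! ### Expectations over binomial random subsets -/

section Expectation

variable {X : Type*} [DecidableEq X]

/-- The expectation of `f` over the random subset of `s` that contains each element of `s`
independently with probability `p`. -/
noncomputable def subsetExp (s : Finset X) (p : ℝ) (f : Finset X → ℝ) : ℝ :=
  ∑ t ∈ s.powerset, p ^ #t * (1 - p) ^ #(s \ t) * f t

/-- Condition on whether `a` is chosen; this recursion drives the inductions on the ground set. -/
lemma subsetExp_insert {s : Finset X} {a : X} (ha : a ∉ s) (p : ℝ) (f : Finset X → ℝ) :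
    subsetExp (insert a s) p f =
      (1 - p) * subsetExp s p f + p * subsetExp s p (fun t => f (insert a t)) := by
  unfold subsetExp
  rw [sum_powerset_insert ha, mul_sum, mul_sum]
  congr 1
  · refine sum_congr rfl fun t ht => ?_
    have hat : a ∉ t := fun h => ha (mem_powerset.1 ht h)
    rw [insert_sdiff_of_notMem _ hat, card_insert_of_notMem (by simp [ha]), pow_succ]
    ring
  · refine sum_congr rfl fun t ht => ?_
    have hat : a ∉ t := fun h => ha (mem_powerset.1 ht h)
    rw [card_insert_of_notMem hat, insert_sdiff_insert, sdiff_insert_of_notMem ha, pow_succ]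
    ring

lemma subsetExp_const (s : Finset X) (p c : ℝ) : subsetExp s p (fun _ => c) = c := by
  induction s using Finset.induction_on with
  | empty => simp [subsetExp]
  | insert a s ha ih => rw [subsetExp_insert ha, ih]; ring

lemma subsetExp_add (s : Finset X) (p : ℝ) (f g : Finset X → ℝ) :
    subsetExp s p (fun t => f t + g t) = subsetExp s p f + subsetExp s p g := by
  simp [subsetExp, mul_add, sum_add_distrib]

lemma subsetExp_const_mul (s : Finset X) (p c : ℝ) (f : Finset X → ℝ) :
    subsetExp s p (fun t => c * f t) = c * subsetExp s p f := by
  simp only [subsetExp, mul_sum]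
  exact sum_congr rfl fun t _ => by ring

lemma subsetExp_mono {s : Finset X} {p : ℝ} (hp0 : 0 ≤ p) (hp1 : p ≤ 1) {f g : Finset X → ℝ}
    (h : ∀ t ⊆ s, f t ≤ g t) : subsetExp s p f ≤ subsetExp s p g := by
  refine sum_le_sum fun t ht => mul_le_mul_of_nonneg_left (h t (mem_powerset.1 ht)) ?_
  have : 0 ≤ 1 - p := by linarith
  positivity

/-- The union of two independent binomial random subsets is a binomial random subset. -/
lemma subsetExp_union (s : Finset X) (p₁ p₂ : ℝ) (f : Finset X → ℝ) :
    subsetExp s p₁ (fun t₁ => subsetExp s p₂ fun t₂ => f (t₁ ∪ t₂)) =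
      subsetExp s (p₁ + p₂ - p₁ * p₂) f := by
  induction s using Finset.induction_on generalizing f with
  | empty => simp [subsetExp]
  | insert a s ha ih =>
    simp only [subsetExp_insert ha, subsetExp_add, subsetExp_const_mul, insert_union,
      union_insert, insert_idem, ih f, ih fun t => f (insert a t)]
    ring

end Expectation

/-! ### Spread weights and minimum fragments -/

section Fragments

variable {X ι : Type*} [DecidableEq X]

/-- A minimum fragment index exists. -/
lemma exists_minimal_fragment (s : Finset ι) (H : ι → Finset X) (W : Finset X) :
    ∃ f : ι → ι, ∀ i ∈ s, f i ∈ s ∧ H (f i) ⊆ H i ∪ W ∧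
      ∀ j ∈ s, H j ⊆ H i ∪ W → #(H (f i) \ W) ≤ #(H j \ W) := by
  classical
  have : ∀ i, ∃ j, i ∈ s → j ∈ s ∧ H j ⊆ H i ∪ W ∧
      ∀ j' ∈ s, H j' ⊆ H i ∪ W → #(H j \ W) ≤ #(H j' \ W) := by
    intro i
    by_cases hi : i ∈ s
    · obtain ⟨j, hj, hmin⟩ := exists_min_image (s.filter fun j => H j ⊆ H i ∪ W)
        (fun j => #(H j \ W)) ⟨i, by simp [hi]⟩
      rw [mem_filter] at hj
      exact ⟨j, fun _ => ⟨hj.1, hj.2, fun j' h1 h2 => hmin j' (mem_filter.2 ⟨h1, h2⟩)⟩⟩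
    · exact ⟨i, fun h => absurd h hi⟩
  choose f hf using this
  exact ⟨f, hf⟩

/-- The expected weight of the members whose minimum fragment has at least `t₀` elements. -/
lemma subsetExp_large_fragment_le {E : Finset X} {s : Finset ι} {H : ι → Finset X} {w : ι → ℝ}
    {q p z l : ℝ} {t₀ : ℕ} (hw : ∀ i ∈ s, 0 ≤ w i) (hq : 0 ≤ q) (hp : 0 < p) (hp1 : p ≤ 1)
    (hz : 1 ≤ z) (hqp : q * z ^ 2 ≤ p)
    (hE : ∀ i ∈ s, H i ⊆ E) (hl : ∀ i ∈ s, (#(H i) : ℝ) ≤ l)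
    (hspread : ∀ I : Finset X, ∑ i ∈ s with I ⊆ H i, w i ≤ q ^ #I)
    (f : Finset X → ι → ι) (hf : ∀ W, ∀ i ∈ s, f W i ∈ s ∧ H (f W i) ⊆ H i ∪ W ∧
      ∀ j ∈ s, H j ⊆ H i ∪ W → #(H (f W i) \ W) ≤ #(H j \ W)) :
    subsetExp E p (fun W => ∑ i ∈ s with t₀ ≤ #(H (f W i) \ W), w i) ≤
      (z⁻¹) ^ t₀ * Real.exp (l / z) := by
  classical
  have hz0 : 0 < z := by linarith
  rcases s.eq_empty_or_nonempty with rfl | ⟨i₀, hi₀⟩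
  · simp only [filter_empty, sum_empty, subsetExp_const]; positivity
  have hl0 : 0 ≤ l := le_trans (by positivity) (hl i₀ hi₀)
  set r : ℝ := q / p with hr
  have hr0 : 0 ≤ r := by positivity
  set T : Finset X → ι → Finset X := fun W i => H (f W i) \ W with hT
  have hTsub : ∀ W, ∀ i ∈ s, T W i ⊆ H i := by
    intro W i hi x hx
    rw [hT, mem_sdiff] at hx
    rcases mem_union.1 ((hf W i hi).2.1 hx.1) with h | h
    · exact h
    · exact absurd h hx.2
  set U : Finset X → Finset (Finset X) := fun W => (s.image (T W)).filter (t₀ ≤ #·) with hU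
  -- Group the bad members by fragment `A`: all of them contain `A`, so spreadness bounds their
  -- total weight by `q ^ #A`.
  have hbad : ∀ W, ∑ i ∈ s with t₀ ≤ #(T W i), w i ≤ ∑ A ∈ U W, q ^ #A := by
    intro W
    rw [← sum_fiberwise_of_maps_to (s := s.filter fun i => t₀ ≤ #(T W i)) (t := U W) (g := T W)]
    · refine sum_le_sum fun A _ => le_trans ?_ (hspread A)
      refine sum_le_sum_of_subset_of_nonneg ?_ ?_
      · intro i hi
        simp only [mem_filter] at hi ⊢
        exact ⟨hi.1.1, hi.2 ▸ hTsub W i hi.1.1⟩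
      · intro i hi _
        exact hw i (mem_filter.1 hi).1
    · intro i hi
      rw [mem_filter] at hi
      simp only [hU, mem_filter, mem_image]
      exact ⟨⟨i, hi.1, rfl⟩, hi.2⟩
  -- `g Z` is a member inside `Z` whenever there is one. It depends on `Z` alone, so `Z = W ∪ A`
  -- will leave only the subsets of `H (g Z)` as candidates for `A`.
  have hg : ∀ Z : Finset X, ∃ j, j ∈ s ∧ ((∃ i ∈ s, H i ⊆ Z) → H j ⊆ Z) := by
    intro Z
    by_cases h : ∃ i ∈ s, H i ⊆ Z
    · obtain ⟨i, hi, hiZ⟩ := h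
      exact ⟨i, hi, fun _ => hiZ⟩
    · exact ⟨i₀, hi₀, fun h' => absurd h' h⟩
  choose g hgs hgZ using hg
  -- `H (g Z)` competes in the choice of the fragment of `i`, and its part outside `W` lies in that
  -- fragment; minimality forces equality.
  have hkey : ∀ W, ∀ i ∈ s, T W i ⊆ H (g (W ∪ T W i)) := by
    intro W i hi
    have h1 : H (f W i) ⊆ W ∪ T W i := by
      intro x hx
      by_cases hxW : x ∈ W
      · exact mem_union_left _ hxW
      · exact mem_union_right _ (mem_sdiff.2 ⟨hx, hxW⟩)
    have h2 := hgZ (W ∪ T W i) ⟨_, (hf W i hi).1, h1⟩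
    have h3 : H (g (W ∪ T W i)) \ W ⊆ T W i := by
      intro x hx
      rw [mem_sdiff] at hx
      rcases mem_union.1 (h2 hx.1) with h | h
      · exact absurd h hx.2
      · exact h
    have h4 : H (g (W ∪ T W i)) ⊆ H i ∪ W := by
      intro x hx
      rcases mem_union.1 (h2 hx) with h | h
      · exact mem_union_right _ h
      · exact mem_union_left _ (hTsub W i hi h)
    have h5 := eq_of_subset_of_card_le h3 ((hf W i hi).2.2 _ (hgs _) h4)
    exact h5.symm.subset.trans sdiff_subset
  have hp1' : 0 ≤ 1 - p := by linarith
  calc subsetExp E p (fun W => ∑ i ∈ s with t₀ ≤ #(T W i), w i)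
      ≤ subsetExp E p (fun W => ∑ A ∈ U W, q ^ #A) :=
        subsetExp_mono hp.le hp1 fun W _ => hbad W
    _ = ∑ x ∈ E.powerset.sigma U, p ^ #x.1 * (1 - p) ^ #(E \ x.1) * q ^ #x.2 := by
        simp only [subsetExp, sum_sigma, mul_sum]
    -- Trade `W` for `W ∪ A`: the extra factor `p ^ #A` turns `q` into `r = q / p`, and surplus
    -- factors `1 - p` are dropped. As `W` and `A` are disjoint, `(W ∪ A, A)` determines `(W, A)`.
    _ ≤ ∑ x ∈ E.powerset.sigma U, p ^ #(x.1 ∪ x.2) * (1 - p) ^ #(E \ (x.1 ∪ x.2)) * r ^ #x.2 := by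
        refine sum_le_sum fun x hx => ?_
        obtain ⟨W, A⟩ := x
        simp only [mem_sigma, mem_powerset, hU, mem_filter, mem_image] at hx ⊢
        obtain ⟨hWE, ⟨i, hi, rfl⟩, -⟩ := hx
        have hdisj : Disjoint W (T W i) := disjoint_sdiff
        rw [card_union_of_disjoint hdisj, pow_add, hr, div_pow]
        have : p ^ #W * p ^ #(T W i) * (1 - p) ^ #(E \ (W ∪ T W i)) * (q ^ #(T W i) / p ^ #(T W i))
            = p ^ #W * (1 - p) ^ #(E \ (W ∪ T W i)) * q ^ #(T W i) := by
          field_simp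
        rw [this]
        refine mul_le_mul_of_nonneg_right (mul_le_mul_of_nonneg_left ?_ (by positivity))
          (by positivity)
        exact pow_le_pow_of_le_one hp1' (by linarith)
          (card_le_card (sdiff_subset_sdiff Subset.rfl subset_union_left))
    _ = ∑ y ∈ (E.powerset.sigma U).image (fun x => (⟨x.1 ∪ x.2, x.2⟩ : Σ _ : Finset X, Finset X)),
          p ^ #y.1 * (1 - p) ^ #(E \ y.1) * r ^ #y.2 := by
        rw [sum_image]
        rintro ⟨W, A⟩ hx ⟨W', A'⟩ hx' heq
        simp only [coe_sigma, Set.mem_sigma_iff, mem_coe, hU, mem_filter, mem_image] at hx hx'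
        simp only [Sigma.mk.injEq, heq_eq_eq] at heq
        obtain ⟨h1, rfl⟩ := heq
        obtain ⟨-, ⟨i, hi, rfl⟩, -⟩ := hx
        obtain ⟨-, ⟨i', hi', hii⟩, -⟩ := hx'
        have hd : Disjoint W (T W i) := disjoint_sdiff
        have hd' : Disjoint W' (T W i) := hii ▸ (disjoint_sdiff : Disjoint W' (T W' i'))
        have : W = W' := by
          rw [← union_sdiff_cancel_right hd, h1, union_sdiff_cancel_right hd']
        rw [this]
    _ ≤ ∑ y ∈ E.powerset.sigma (fun Z => (H (g Z)).powerset.filter (t₀ ≤ #·)),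
          p ^ #y.1 * (1 - p) ^ #(E \ y.1) * r ^ #y.2 := by
        refine sum_le_sum_of_subset_of_nonneg ?_ fun _ _ _ => by positivity
        intro y hy
        rw [mem_image] at hy
        obtain ⟨⟨W, A⟩, hx, rfl⟩ := hy
        simp only [mem_sigma, mem_powerset, hU, mem_filter, mem_image] at hx ⊢
        obtain ⟨hWE, ⟨i, hi, rfl⟩, ht⟩ := hx
        exact ⟨union_subset hWE ((hTsub W i hi).trans (hE i hi)), hkey W i hi, ht⟩
    _ = subsetExp E p (fun Z => ∑ A ∈ (H (g Z)).powerset with t₀ ≤ #A, r ^ #A) := by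
        simp only [subsetExp, sum_sigma, mul_sum]
    _ ≤ subsetExp E p (fun _ => (z⁻¹) ^ t₀ * Real.exp (l / z)) := by
        refine subsetExp_mono hp.le hp1 fun Z _ => ?_
        have hrz : r * z ≤ z⁻¹ := by
          rw [hr, div_mul_eq_mul_div, div_le_iff₀ hp, ← div_eq_inv_mul, le_div_iff₀ hz0]
          nlinarith
        calc ∑ A ∈ (H (g Z)).powerset with t₀ ≤ #A, r ^ #A
            ≤ ∑ A ∈ (H (g Z)).powerset with t₀ ≤ #A, (z⁻¹) ^ t₀ * (r * z) ^ #A := by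
              refine sum_le_sum fun A hA => ?_
              rw [mem_filter] at hA
              have : (z⁻¹) ^ #A ≤ (z⁻¹) ^ t₀ :=
                pow_le_pow_of_le_one (by positivity) (inv_le_one_of_one_le₀ hz) hA.2
              calc r ^ #A = (z⁻¹) ^ #A * (r * z) ^ #A := by
                    rw [← mul_pow]; congr 1; field_simp
                _ ≤ _ := by gcongr
          _ ≤ ∑ A ∈ (H (g Z)).powerset, (z⁻¹) ^ t₀ * (r * z) ^ #A :=
              sum_le_sum_of_subset_of_nonneg (filter_subset _ _) fun _ _ _ => by positivity
          _ = (z⁻¹) ^ t₀ * (r * z + 1) ^ #(H (g Z)) := by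
              rw [← mul_sum, ← sum_pow_mul_eq_add_pow]; simp
          _ ≤ (z⁻¹) ^ t₀ * Real.exp (l / z) := by
              gcongr
              calc (r * z + 1) ^ #(H (g Z)) ≤ (Real.exp (z⁻¹)) ^ #(H (g Z)) := by
                    gcongr
                    linarith [Real.add_one_le_exp (z⁻¹)]
                _ = Real.exp (#(H (g Z)) * z⁻¹) := by rw [← Real.exp_nat_mul]
                _ ≤ _ := by
                    rw [Real.exp_le_exp, div_eq_mul_inv]
                    have := hl _ (hgs Z)
                    gcongr
    _ = _ := subsetExp_const _ _ _

open Classical in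
/-- Spread weights are captured by a random set: if `w` is `q`-spread on sets of size below `z ^ J`
and `q * z ^ 2 ≤ p'`, then `J` rounds of exposure with probability `p'` suffice. -/
theorem spread_mul_subsetExp_le {E : Finset X} {w : ι → ℝ}
    {q p' z : ℝ} (hq : 0 ≤ q) (hp' : 0 < p') (hp1' : p' < 1)
    (hz : Real.exp 1 ≤ z) (hqp : q * z ^ 2 ≤ p') (J : ℕ) :
    ∀ (s : Finset ι) (H : ι → Finset X) (p : ℝ), (∀ i ∈ s, 0 ≤ w i) → J * p' ≤ p → p ≤ 1 →
    (∀ i ∈ s, H i ⊆ E) → (∀ i ∈ s, (#(H i) : ℝ) < z ^ J) →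
    (∀ I : Finset X, ∑ i ∈ s with I ⊆ H i, w i ≤ q ^ #I) →
    (∑ i ∈ s, w i) * subsetExp E p (fun W => if ∃ i ∈ s, H i ⊆ W then 0 else 1) ≤
      J * (Real.exp 1 / z) := by
  have hz1 : 1 ≤ z := le_trans (by linarith [Real.add_one_le_exp (1 : ℝ)]) hz
  have hz0 : 0 < z := by linarith
  induction J with
  | zero =>
    intro s H p hw _ _ _ hsize _
    rcases s.eq_empty_or_nonempty with rfl | ⟨i, hi⟩
    · simp
    · have : ∀ W, ∃ i ∈ s, H i ⊆ W := by
        intro W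
        have h := hsize i hi
        rw [pow_zero] at h
        have h0 : #(H i) = 0 := by exact_mod_cast Nat.lt_one_iff.1 (by exact_mod_cast h)
        rw [card_eq_zero] at h0
        exact ⟨i, hi, by simp [h0]⟩
      simp [this, subsetExp_const]
  | succ J ih =>
    intro s H p hw hpJ hp1 hE hsize hspread
    have hJ0 : (0 : ℝ) ≤ J := by positivity
    push_cast at hpJ
    -- The probability for the later rounds: independent sets of densities `p'` and `p''` have a
    -- union of density `p`.
    set p'' : ℝ := (p - p') / (1 - p') with hp''
    have h1p : 0 < 1 - p' := by linarith
    have hcomp : p = p' + p'' - p' * p'' := by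
      rw [hp'']; field_simp; ring
    have hp''1 : p'' ≤ 1 := by rw [hp'', div_le_one h1p]; linarith
    have hp''J : J * p' ≤ p'' := by
      rw [hp'', le_div_iff₀ h1p]
      nlinarith [mul_nonneg hJ0 hp'.le, mul_nonneg (mul_nonneg hJ0 hp'.le) hp'.le]
    have hp''0 : 0 ≤ p'' := le_trans (by positivity) hp''J
    choose f hf using fun W => exists_minimal_fragment s H W
    set T : Finset X → ι → Finset X := fun W i => H (f W i) \ W with hT
    -- An integer size below this ceiling is below `z ^ J` itself, as the induction hypothesis
    -- requires.
    set t₀ := ⌈z ^ J⌉₊ with ht₀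
    set good : Finset X → Finset ι := fun W => s.filter fun i => ¬ t₀ ≤ #(T W i) with hgood
    have hA0 : 0 ≤ ∑ i ∈ s, w i := sum_nonneg hw
    -- Members with large fragments are given up at the cost of their weight; the others are
    -- replaced by their fragments, which remain spread. Total weight multiplies the failure
    -- probability, so no renormalisation is needed.
    have hround : ∀ W₁ : Finset X, (∑ i ∈ s, w i) *
        subsetExp E p'' (fun W₂ => if ∃ i ∈ s, H i ⊆ W₁ ∪ W₂ then 0 else 1) ≤
        (∑ i ∈ s with t₀ ≤ #(T W₁ i), w i) + J * (Real.exp 1 / z) := by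
      intro W₁
      have hsplit : ∑ i ∈ s, w i = (∑ i ∈ s with t₀ ≤ #(T W₁ i), w i) + ∑ i ∈ good W₁, w i :=
        (sum_filter_add_sum_filter_not s _ _).symm
      have hTsub : ∀ i ∈ s, T W₁ i ⊆ H i := by
        intro i hi x hx
        rw [hT, mem_sdiff] at hx
        rcases mem_union.1 ((hf W₁ i hi).2.1 hx.1) with h | h
        · exact h
        · exact absurd h hx.2
      have hgs : ∀ i ∈ good W₁, i ∈ s := fun i hi => (mem_filter.1 hi).1
      have hrest := ih (good W₁) (T W₁) p'' (fun i hi => hw i (hgs i hi)) hp''J hp''1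
        (fun i hi => (hTsub i (hgs i hi)).trans (hE i (hgs i hi)))
        (fun i hi => by
          have := (mem_filter.1 hi).2
          rw [not_le, ht₀, Nat.lt_ceil] at this
          exact this)
        (fun I => le_trans (sum_le_sum_of_subset_of_nonneg
          (fun i hi => by
            rw [mem_filter] at hi ⊢
            exact ⟨hgs i hi.1, hi.2.trans (hTsub i (hgs i hi.1))⟩)
          (fun i hi _ => hw i (mem_filter.1 hi).1)) (hspread I))
      have hfail : subsetExp E p'' (fun W₂ => if ∃ i ∈ s, H i ⊆ W₁ ∪ W₂ then 0 else 1) ≤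
          subsetExp E p'' (fun W₂ => if ∃ i ∈ good W₁, T W₁ i ⊆ W₂ then 0 else 1) := by
        refine subsetExp_mono hp''0 hp''1 fun W₂ _ => ?_
        by_cases h : ∃ i ∈ good W₁, T W₁ i ⊆ W₂
        · obtain ⟨i, hi, hiW⟩ := h
          have : ∃ i ∈ s, H i ⊆ W₁ ∪ W₂ := ⟨f W₁ i, (hf W₁ i (hgs i hi)).1, fun x hx => by
            by_cases hxW : x ∈ W₁
            · exact mem_union_left _ hxW
            · exact mem_union_right _ (hiW (mem_sdiff.2 ⟨hx, hxW⟩))⟩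
          rw [if_pos this]
          split_ifs <;> norm_num
        · rw [if_neg h]
          split_ifs <;> norm_num
      have hle1 : subsetExp E p'' (fun W₂ => if ∃ i ∈ s, H i ⊆ W₁ ∪ W₂ then 0 else 1) ≤ 1 := by
        refine (subsetExp_mono (g := fun _ => 1) hp''0 hp''1 fun W₂ _ => ?_).trans
          (subsetExp_const E p'' 1).le
        split_ifs <;> norm_num
      have hb0 : 0 ≤ ∑ i ∈ s with t₀ ≤ #(T W₁ i), w i :=
        sum_nonneg fun i hi => hw i (mem_filter.1 hi).1
      have hg0 : 0 ≤ ∑ i ∈ good W₁, w i := sum_nonneg fun i hi => hw i (hgs i hi)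
      rw [hsplit, add_mul]
      exact add_le_add (mul_le_of_le_one_right hb0 hle1)
        ((mul_le_mul_of_nonneg_left hfail hg0).trans hrest)
    have hbad := subsetExp_large_fragment_le (E := E) (t₀ := t₀) (l := z ^ (J + 1)) hw hq hp'
      hp1'.le hz1 hqp hE (fun i hi => (hsize i hi).le) hspread f hf
    have hbound : (z⁻¹) ^ t₀ * Real.exp (z ^ (J + 1) / z) ≤ Real.exp 1 / z := by
      have h1 : z ^ (J + 1) / z = z ^ J := by field_simp; ring
      have h2 : z ^ J ≤ t₀ := Nat.le_ceil _
      have h3 : 1 ≤ t₀ := Nat.one_le_ceil_iff.2 (by positivity)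
      rw [h1]
      calc (z⁻¹) ^ t₀ * Real.exp (z ^ J) ≤ (z⁻¹) ^ t₀ * Real.exp (t₀ * 1) := by
            gcongr; linarith
        _ = (Real.exp 1 / z) ^ t₀ := by
            rw [Real.exp_nat_mul, ← mul_pow]; congr 1; ring
        _ ≤ (Real.exp 1 / z) ^ 1 :=
            pow_le_pow_of_le_one (by positivity) (by rwa [div_le_one hz0]) h3
        _ = _ := pow_one _
    rw [hcomp, ← subsetExp_union, ← subsetExp_const_mul]
    calc _ ≤ subsetExp E p' (fun W₁ => (∑ i ∈ s with t₀ ≤ #(T W₁ i), w i)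
          + J * (Real.exp 1 / z)) := subsetExp_mono hp'.le hp1'.le fun W₁ _ => hround W₁
      _ ≤ Real.exp 1 / z + J * (Real.exp 1 / z) := by
          rw [subsetExp_add, subsetExp_const]
          linarith [hbad.trans hbound]
      _ = _ := by push_cast; ring

end Fragments

end PerturbedGraph

namespace PerturbedGraph

/-! ### The binomial random graph as a random edge set -/

section Binomial

open Classical in
/-- Probabilities in the binomial random graph as finite expectations over edge sets. -/
lemma binomialRandom_real_eq_subsetExp {V : Type*} [Fintype V] (p : unitInterval)
    (Q : SimpleGraph V → Prop) :
    (SimpleGraph.binomialRandom V p).real {H | Q H} =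
      subsetExp (univ.filter fun e : Sym2 V => ¬ e.IsDiag) p
        (fun W => if Q (SimpleGraph.fromEdgeSet (W : Set (Sym2 V))) then 1 else 0) := by
  have hE : #(univ.filter fun e : Sym2 V => ¬ e.IsDiag) = (Nat.card V).choose 2 := by
    rw [← Fintype.card_subtype, Sym2.card_subtype_not_diag, Nat.card_eq_fintype_card]
  have h1 : (SimpleGraph.binomialRandom V p).real {H | Q H} =
      ∑ H ∈ univ.filter Q, (SimpleGraph.binomialRandom V p).real {H} := by
    have : MeasurableSingletonClass (SimpleGraph V) := ⟨fun H => by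
      have h := SimpleGraph.measurable_edgeSet (measurableSet_singleton H.edgeSet)
      convert h using 1
      ext H'
      simp⟩
    rw [MeasureTheory.sum_measureReal_singleton]
    simp
  have h2 := sum_filter_of_ne (s := (univ.filter fun e : Sym2 V => ¬ e.IsDiag).powerset)
    (f := fun W => (p : ℝ) ^ #W * (1 - p) ^ #((univ.filter fun e : Sym2 V => ¬ e.IsDiag) \ W) *
      if Q (SimpleGraph.fromEdgeSet (W : Set (Sym2 V))) then 1 else 0)
    (p := fun W => Q (SimpleGraph.fromEdgeSet (W : Set (Sym2 V)))) (fun W _ hW => by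
      by_contra h
      simp [h] at hW)
  rw [h1, subsetExp, ← h2]
  have hinv : ∀ W : Finset (Sym2 V), W ⊆ (univ.filter fun e : Sym2 V => ¬ e.IsDiag) →
      (SimpleGraph.fromEdgeSet (W : Set (Sym2 V))).edgeFinset = W := by
    intro W hW
    ext e
    simp only [SimpleGraph.mem_edgeFinset, SimpleGraph.edgeSet_fromEdgeSet, Set.mem_sdiff, mem_coe]
    constructor
    · exact fun h => h.1
    · intro h
      have := hW h
      simp only [mem_filter, mem_univ, true_and] at this
      exact ⟨h, by simpa using this⟩
  refine sum_bij' (fun H _ => H.edgeFinset)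
    (fun W _ => SimpleGraph.fromEdgeSet (W : Set (Sym2 V))) ?_ ?_ ?_ ?_ ?_
  · intro H hH
    simp only [mem_filter, mem_univ, true_and, mem_powerset, SimpleGraph.coe_edgeFinset,
      SimpleGraph.fromEdgeSet_edgeSet] at hH ⊢
    refine ⟨fun e he => ?_, hH⟩
    simp only [mem_filter, mem_univ, true_and]
    exact H.not_isDiag_of_mem_edgeFinset he
  · intro W hW
    simpa using (mem_filter.1 hW).2
  · intro H _
    simp
  · intro W hW
    convert hinv W (mem_powerset.1 (mem_filter.1 hW).1)
  · intro H hH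
    have hsub : H.edgeFinset ⊆ (univ.filter fun e : Sym2 V => ¬ e.IsDiag) := by
      intro e he
      simp only [mem_filter, mem_univ, true_and]
      exact H.not_isDiag_of_mem_edgeFinset he
    simp only [SimpleGraph.coe_edgeFinset, SimpleGraph.fromEdgeSet_edgeSet,
      (mem_filter.1 hH).2, if_true, mul_one]
    rw [card_sdiff_of_subset hsub, hE, MeasureTheory.measureReal_def,
      SimpleGraph.binomialRandom_singleton]
    simp [Set.ncard_eq_toFinset_card', SimpleGraph.edgeFinset]

end Binomial

/-! ### Density of the cycle power away from the centres -/

section Density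

variable {n : ℕ}

/-- The number of forward steps of length at most `k` that stay inside `W`. -/
def forwardDegree (k : ℕ) (W : Finset (ZMod n)) (w : ZMod n) : ℕ :=
  #{j ∈ Icc 1 k | w + (j : ℕ) ∈ W}

lemma forwardDegree_le (k : ℕ) (W : Finset (ZMod n)) (w : ZMod n) : forwardDegree k W w ≤ k :=
  (card_filter_le _ _).trans (by simp)

/-- A nonempty set missing enough residues has an element followed by a gap of length `k`. -/
lemma exists_forward_gap [NeZero n] {k : ℕ} {W : Finset (ZMod n)} (hW : W.Nonempty) (h : k * #W < n) :
    ∃ w ∈ W, ∀ j ∈ Icc 1 k, w + (j : ℕ) ∉ W := by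
  by_contra! hcon
  -- Without a gap, the union of the translates of `W` by `0, …, k - 1` is closed under adding one.
  -- It is then everything, although it has at most `k * #W < n` elements.
  set S : Finset (ZMod n) := (range k).biUnion fun i => W.image (· + (i : ZMod n)) with hS
  have hmem : ∀ x, x ∈ S ↔ ∃ i < k, ∃ w ∈ W, w + (i : ZMod n) = x := by
    intro x; simp only [hS, mem_biUnion, mem_range, mem_image]
  have hclosed : ∀ x ∈ S, x + 1 ∈ S := by
    intro x hx
    obtain ⟨i, hi, w, hw, rfl⟩ := (hmem x).1 hx
    rw [hmem]
    by_cases hik : i + 1 < k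
    · exact ⟨i + 1, hik, w, hw, by push_cast; ring⟩
    · obtain ⟨j, hj, hjW⟩ := hcon w hw
      rw [mem_Icc] at hj
      refine ⟨k - j, by omega, _, hjW, ?_⟩
      have : k = i + 1 := by omega
      rw [Nat.cast_sub hj.2, this]; push_cast; ring
  have huniv : S = univ := by
    obtain ⟨w, hw⟩ := hW
    obtain ⟨j, hj, -⟩ := hcon w hw
    rw [mem_Icc] at hj
    have hwS : w ∈ S := (hmem w).2 ⟨0, by omega, w, hw, by simp⟩
    have hall : ∀ t : ℕ, w + t ∈ S := by
      intro t
      induction t with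
      | zero => simpa using hwS
      | succ t ih => have := hclosed _ ih; push_cast; rwa [← add_assoc]
    refine eq_univ_iff_forall.2 fun x => ?_
    have := hall (x - w).val
    rwa [ZMod.natCast_zmod_val, add_sub_cancel] at this
  have hcard : #S ≤ k * #W := by
    refine (card_biUnion_le).trans ?_
    calc ∑ i ∈ range k, #(W.image (· + (i : ZMod n))) ≤ ∑ i ∈ range k, #W :=
          sum_le_sum fun i _ => card_image_le
      _ = k * #W := by simp
  rw [huniv, card_univ, ZMod.card] at hcard
  omega

/-- Small sets span few edges of the cycle power. -/
lemma sum_forwardDegree_le_of_small [NeZero n] {k : ℕ} (hk : 2 ≤ k) {W : Finset (ZMod n)} (hW : 2 ≤ #W)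
    (h : k * #W < n) : (∑ w ∈ W, forwardDegree k W w) + (k - 1) ≤ k * (#W - 1) := by
  -- Two successive last elements: `a` has forward degree zero, and `b`, last once `a` is removed,
  -- can only reach `a`. These two account for the saving of `k - 1`.
  obtain ⟨a, ha, hgap⟩ := exists_forward_gap (card_pos.1 (by omega)) h
  have hcard : #(W.erase a) = #W - 1 := card_erase_of_mem ha
  obtain ⟨b, hb, hgap'⟩ := exists_forward_gap (k := k) (W := W.erase a) (card_pos.1 (by omega))
    (lt_of_le_of_lt (Nat.mul_le_mul_left k (card_erase_le)) h)
  have hkn : k < n := lt_of_le_of_lt (Nat.le_mul_of_pos_right k (by omega)) h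
  have ha0 : forwardDegree k W a = 0 := by
    rw [forwardDegree, card_eq_zero, filter_eq_empty_iff]
    exact hgap
  have hb1 : forwardDegree k W b ≤ 1 := by
    rw [forwardDegree, card_le_one]
    intro i hi j hj
    rw [mem_filter] at hi hj
    have hia : b + (i : ℕ) = a := by
      by_contra hne
      exact hgap' i hi.1 (mem_erase.2 ⟨hne, hi.2⟩)
    have hja : b + (j : ℕ) = a := by
      by_contra hne
      exact hgap' j hj.1 (mem_erase.2 ⟨hne, hj.2⟩)
    have hij : (i : ZMod n) = j := add_left_cancel (hia.trans hja.symm)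
    rw [ZMod.natCast_eq_natCast_iff', Nat.mod_eq_of_lt, Nat.mod_eq_of_lt] at hij
    · exact hij
    · have := (mem_Icc.1 hj.1).2; omega
    · have := (mem_Icc.1 hi.1).2; omega
  rw [← add_sum_erase W _ ha, ← add_sum_erase (W.erase a) _ hb, ha0]
  have hrest : ∑ w ∈ (W.erase a).erase b, forwardDegree k W w ≤ #((W.erase a).erase b) * k :=
    sum_le_card_nsmul _ _ _ fun w _ => forwardDegree_le k W w
  have hcard2 : #((W.erase a).erase b) = #W - 2 := by
    rw [card_erase_of_mem hb, hcard]; omega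
  rw [hcard2] at hrest
  obtain ⟨v, hv⟩ : ∃ v, #W = v + 2 := ⟨#W - 2, by omega⟩
  rw [hv] at hrest ⊢
  simp only [Nat.add_sub_cancel] at hrest
  have : k * (v + 2 - 1) = v * k + k := by
    rw [show v + 2 - 1 = v + 1 by omega]; ring
  omega

/-- A set avoiding a syndetic set of centers has many elements with a missing successor. -/
lemma card_le_mul_card_missing_succ {M : ℕ} {C W : Finset (ZMod n)} (hCW : Disjoint C W)
    (hC : ∀ x : ZMod n, ∃ i ≤ M, x + (i : ℕ) ∈ C) :
    #W ≤ (M + 1) * #{d ∈ W | d + 1 ∉ W} := by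
  have hcover : W ⊆ (range (M + 1)).biUnion fun i =>
      ({d ∈ W | d + 1 ∉ W}).image (· - (i : ZMod n)) := by
    intro w hw
    -- Walking forward from `w`, one leaves `W` at the latest at a centre; the last element before
    -- the exit has its successor missing.
    have hne : ∃ i, w + ((i + 1 : ℕ) : ZMod n) ∉ W := by
      obtain ⟨i, -, hiC⟩ := hC w
      rcases i with _ | i
      · exact absurd hw (disjoint_left.1 hCW (by simpa using hiC))
      · exact ⟨i, disjoint_left.1 hCW hiC⟩
    classical
    have hspec := Nat.find_spec hne
    set j := Nat.find hne with hj
    have hjM : j ≤ M := by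
      obtain ⟨i, hi, hiC⟩ := hC w
      rcases i with _ | i
      · exact absurd hw (disjoint_left.1 hCW (by simpa using hiC))
      · exact (Nat.find_min' hne (disjoint_left.1 hCW hiC)).trans (by omega)
    have hjW : w + (j : ZMod n) ∈ W := by
      rcases hj' : j with _ | j'
      · simpa using hw
      · have := Nat.find_min hne (m := j') (by omega)
        simpa using this
    simp only [mem_biUnion, mem_range, mem_image, mem_filter]
    refine ⟨j, by omega, w + j, ⟨hjW, ?_⟩, by ring⟩
    have : w + (j : ZMod n) + 1 = w + ((j + 1 : ℕ) : ZMod n) := by push_cast; ring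
    rwa [this]
  calc #W ≤ _ := card_le_card hcover
    _ ≤ ∑ i ∈ range (M + 1), #(({d ∈ W | d + 1 ∉ W}).image (· - (i : ZMod n))) := card_biUnion_le
    _ ≤ ∑ i ∈ range (M + 1), #{d ∈ W | d + 1 ∉ W} := sum_le_sum fun _ _ => card_image_le
    _ = _ := by simp

/-- An element whose successor is missing loses at least the step of length one. -/
lemma sum_forwardDegree_add_card_le {k : ℕ} (hk : 1 ≤ k) (W : Finset (ZMod n)) :
    (∑ w ∈ W, forwardDegree k W w) + #{d ∈ W | d + 1 ∉ W} ≤ k * #W := by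
  rw [card_filter, ← sum_add_distrib]
  calc _ ≤ ∑ w ∈ W, k := by
        refine sum_le_sum fun w _ => ?_
        by_cases h : w + 1 ∉ W
        · rw [if_pos h]
          have : forwardDegree k W w < #(Icc 1 k) := by
            refine card_lt_card (filter_ssubset.2 ⟨1, by simp [hk], by simpa using h⟩)
          simp at this; omega
        · rw [if_neg h]
          exact forwardDegree_le k W w
    _ = _ := by simp [mul_comm]

/-- The density of the cycle power with a syndetic set of centers removed stays below `k`. -/
theorem sum_forwardDegree_le [NeZero n] {k M : ℕ} (hk : 2 ≤ k) {C W : Finset (ZMod n)} (hCW : Disjoint C W)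
    (hC : ∀ x : ZMod n, ∃ i ≤ M, x + (i : ℕ) ∈ C) (hn : 2 * k ^ 2 * (M + 1) < n)
    (hW : W.Nonempty) :
    (∑ w ∈ W, (forwardDegree k W w : ℝ)) ≤ (k - 1 / (2 * k * (M + 1))) * (#W - 1) := by
  have hW1 : 1 ≤ #W := card_pos.2 hW
  have hk' : (2 : ℝ) ≤ k := by exact_mod_cast hk
  have hM : (0 : ℝ) ≤ M := by positivity
  have hv1 : (1 : ℝ) ≤ #W := by exact_mod_cast hW1
  -- Below this size, the boundary saving `k - 1 ≥ 1` exceeds the required `(#W - 1) / (2 * k * (M +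
  -- 1))`. Above it, missing successors save `#W / (M + 1)`: one half pays for the `k` in `k * (#W -
  -- 1)`, the other for the smaller density.
  rcases Nat.lt_or_ge (#W) (2 * k * (M + 1)) with hsmall | hlarge
  · have hlt : k * #W < n := by
      refine lt_of_le_of_lt (Nat.mul_le_mul_left k hsmall.le) (lt_of_eq_of_lt (by ring) hn)
    rcases Nat.lt_or_ge (#W) 2 with h2 | h2
    · have h1 : #W = 1 := by omega
      obtain ⟨a, ha, hgap⟩ := exists_forward_gap hW hlt
      obtain ⟨b, hb⟩ := card_eq_one.1 h1
      have : a = b := by simpa [hb] using ha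
      subst this
      have ha0 : forwardDegree k W a = 0 := by
        rw [forwardDegree, card_eq_zero, filter_eq_empty_iff]
        exact hgap
      rw [h1]
      conv_lhs => rw [hb]
      rw [sum_singleton, ← hb, ha0]
      simp
    · have h := sum_forwardDegree_le_of_small hk h2 hlt
      have h' : (∑ w ∈ W, (forwardDegree k W w : ℝ)) + (k - 1) ≤ k * (#W - 1) := by
        have : (((∑ w ∈ W, forwardDegree k W w) + (k - 1) : ℕ) : ℝ) ≤ ((k * (#W - 1) : ℕ) : ℝ) := by
          exact_mod_cast h
        rw [Nat.cast_add, Nat.cast_sub (by omega), Nat.cast_mul, Nat.cast_sub hW1] at this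
        simpa using this
      have hs : (#W : ℝ) ≤ 2 * k * (M + 1) := by exact_mod_cast hsmall.le
      have : 1 / (2 * k * (M + 1)) * ((#W : ℝ) - 1) ≤ 1 := by
        rw [div_mul_eq_mul_div, div_le_one (by positivity)]
        linarith
      linarith
  · have h1 := card_le_mul_card_missing_succ hCW hC
    have h2 := sum_forwardDegree_add_card_le (k := k) (by omega) W
    set D := #{d ∈ W | d + 1 ∉ W}
    have h1' : (#W : ℝ) ≤ (M + 1) * D := by exact_mod_cast h1
    have h2' : (∑ w ∈ W, (forwardDegree k W w : ℝ)) + D ≤ k * #W := by exact_mod_cast h2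
    have hl : 2 * k * (M + 1) ≤ (#W : ℝ) := by exact_mod_cast hlarge
    have h3 : (#W : ℝ) / (M + 1) ≤ D := by rw [div_le_iff₀ (by positivity)]; linarith
    have h4 : (k : ℝ) ≤ #W / (2 * (M + 1)) := by
      rw [le_div_iff₀ (by positivity)]; linarith
    have h5 : (#W : ℝ) / (M + 1) = #W / (2 * (M + 1)) + #W / (2 * (M + 1)) := by
      field_simp; ring
    have h6 : 1 / (2 * k * (M + 1)) * ((#W : ℝ) - 1) ≤ #W / (2 * (M + 1)) := by
      rw [div_mul_eq_mul_div, one_mul]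
      refine div_le_div₀ (by positivity) (by linarith) (by positivity) ?_
      nlinarith
    linarith

end Density

end PerturbedGraph

namespace PerturbedGraph

/-! ### Random distinct representatives -/

section Sequential

variable {V : Type*} [Fintype V]

/-- Random sequential choice of distinct representatives from large sets, together with
multiplicative bounds on its marginals. -/
lemma exists_sequential_weights {a : ℝ} (ha : 0 < a) (M : ℕ) (A : Fin M → Finset V)
    (hA : ∀ i, a + M ≤ #(A i)) :
    ∃ w : (Fin M → V) → ℝ, (∀ f, 0 ≤ w f) ∧ ∑ f, w f = 1 ∧
      (∀ f, w f ≠ 0 → Function.Injective f ∧ ∀ i, f i ∈ A i) ∧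
      ∀ (g : Fin M → V → ℝ) (b : Fin M → ℝ), (∀ i v, 0 ≤ g i v) →
        (∀ i (S : Finset V), a ≤ #S → ∑ v ∈ S, g i v ≤ b i * #S) →
        ∑ f, w f * ∏ i, g i (f i) ≤ ∏ i, b i := by
  classical
  induction M with
  | zero =>
    refine ⟨fun _ => 1, fun _ => zero_le_one, by simp, fun f _ =>
      ⟨Function.injective_of_subsingleton f, fun i => i.elim0⟩, fun g b _ _ => by simp⟩
  | succ M ih =>
    obtain ⟨w, hw0, hw1, hwsupp, hwm⟩ := ih (fun i => A i.succ) fun i => by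
      have := hA i.succ; push_cast at this; linarith
    -- Coordinate `0` is drawn last, uniformly from `A 0` minus the values already used; at least
    -- `a` choices remain.
    set S : (Fin M → V) → Finset V := fun f => A 0 \ univ.image f with hS
    have hSa : ∀ f, a ≤ #(S f) := by
      intro f
      have h1 : #(A 0) - #(univ.image f) ≤ #(S f) := le_card_sdiff _ _
      have h2 : #(univ.image f) ≤ M := by simpa using card_image_le (s := univ) (f := f)
      have h3 := hA 0
      have h4 : (#(A 0) : ℝ) ≤ #(S f) + M := by exact_mod_cast (by omega : #(A 0) ≤ #(S f) + M)
      push_cast at h3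
      linarith
    have hSpos : ∀ f, (0 : ℝ) < #(S f) := fun f => ha.trans_le (hSa f)
    set w' : (Fin (M + 1) → V) → ℝ := fun f =>
      w (Fin.tail f) * if f 0 ∈ S (Fin.tail f) then (#(S (Fin.tail f)) : ℝ)⁻¹ else 0 with hw'
    have hsum : ∀ F : V → (Fin M → V) → ℝ, ∑ f, w' f * F (f 0) (Fin.tail f) =
        ∑ f, w f * ((#(S f) : ℝ)⁻¹ * ∑ v ∈ S f, F v f) := by
      intro F
      rw [← Equiv.sum_comp (Fin.consEquiv fun _ => V), Fintype.sum_prod_type, sum_comm]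
      refine sum_congr rfl fun f _ => ?_
      have h0 : ∀ v, Fin.consEquiv (fun _ : Fin (M + 1) => V) (v, f) 0 = v := fun v => rfl
      have ht : ∀ v, Fin.tail (Fin.consEquiv (fun _ : Fin (M + 1) => V) (v, f)) = f := fun v => rfl
      simp only [hw', h0, ht]
      rw [mul_sum, mul_sum, ← sum_filter_add_sum_filter_not univ (· ∈ S f), filter_mem_eq_inter,
        univ_inter, sum_eq_zero (s := filter _ _), add_zero]
      · refine sum_congr rfl fun v hv => ?_
        rw [if_pos hv]; ring
      · intro v hv
        rw [if_neg (mem_filter.1 hv).2]; ring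
    refine ⟨w', fun f => ?_, ?_, fun f hf => ?_, fun g b hg hb => ?_⟩
    · refine mul_nonneg (hw0 _) ?_
      split_ifs <;> positivity
    · have := hsum fun _ _ => 1
      simp only [mul_one, sum_const, nsmul_eq_mul] at this
      rw [this, ← hw1]
      refine sum_congr rfl fun f _ => ?_
      rw [inv_mul_cancel₀ (hSpos f).ne', mul_one]
    · have h1 : w (Fin.tail f) ≠ 0 := left_ne_zero_of_mul hf
      have h2 : f 0 ∈ S (Fin.tail f) := by
        by_contra h
        exact right_ne_zero_of_mul hf (if_neg h)
      obtain ⟨hinj, hmem⟩ := hwsupp _ h1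
      rw [hS, mem_sdiff] at h2
      constructor
      · rw [← Fin.cons_self_tail f, Fin.cons_injective_iff]
        exact ⟨by simpa using h2.2, hinj⟩
      · intro i
        refine Fin.cases h2.1 (fun j => hmem j) i
    · have hb0 : 0 ≤ b 0 := by
        by_contra! h
        have hne : a ≤ #(A 0) := by
          have := hA 0
          push_cast at this
          linarith [(Nat.cast_nonneg M : (0 : ℝ) ≤ M)]
        have h1 := hb 0 _ hne
        have h2 : 0 ≤ ∑ v ∈ A 0, g 0 v := sum_nonneg fun v _ => hg 0 v
        nlinarith [ha.trans_le hne]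
      have h := hsum fun v f => g 0 v * ∏ i : Fin M, g i.succ (f i)
      have hcongr : ∑ f, w' f * ∏ i, g i (f i) =
          ∑ f, w' f * (g 0 (f 0) * ∏ i : Fin M, g i.succ (Fin.tail f i)) :=
        sum_congr rfl fun f _ => by rw [Fin.prod_univ_succ]; rfl
      rw [hcongr, h, Fin.prod_univ_succ]
      calc _ ≤ ∑ f, b 0 * (w f * ∏ i : Fin M, g i.succ (f i)) := by
            refine sum_le_sum fun f _ => ?_
            have hG : 0 ≤ ∏ i : Fin M, g i.succ (f i) := prod_nonneg fun i _ => hg _ _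
            rw [← sum_mul]
            have h1 : (#(S f) : ℝ)⁻¹ * ∑ v ∈ S f, g 0 v ≤ b 0 := by
              rw [inv_mul_le_iff₀ (hSpos f), mul_comm]
              exact hb 0 _ (hSa f)
            calc w f * ((#(S f) : ℝ)⁻¹ * ((∑ v ∈ S f, g 0 v) * ∏ i : Fin M, g i.succ (f i)))
                = ((#(S f) : ℝ)⁻¹ * ∑ v ∈ S f, g 0 v) *
                  (w f * ∏ i : Fin M, g i.succ (f i)) := by ring
              _ ≤ _ := mul_le_mul_of_nonneg_right h1 (mul_nonneg (hw0 f) hG)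
        _ = b 0 * ∑ f, w f * ∏ i : Fin M, g i.succ (f i) := by rw [mul_sum]
        _ ≤ _ := mul_le_mul_of_nonneg_left
            (hwm _ _ (fun i v => hg _ v) (fun i T hT => hb _ T hT)) hb0

end Sequential

/-! ### Vertex-spread random bijections -/

section Counting

variable {P V : Type*} [Fintype P] [Fintype V]

lemma exists_equiv_extending {ι : Type*} (h : Fintype.card P = Fintype.card V) {f : ι → P}
    (hf : Function.Injective f) {g : ι → V} (hg : Function.Injective g) :
    ∃ φ : P ≃ V, ∀ i, φ (f i) = g i := by
  classical
  let e₀ : P ≃ V := Fintype.equivOfCardEq h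
  have hf' : Function.Injective (e₀ ∘ f) := e₀.injective.comp hf
  let e : {x // x ∈ Set.range (e₀ ∘ f)} ≃ {x // x ∈ Set.range g} :=
    (Equiv.ofInjective _ hf').symm.trans (Equiv.ofInjective _ hg)
  refine ⟨e₀.trans e.extendSubtype, fun i => ?_⟩
  rw [Equiv.trans_apply, Equiv.extendSubtype_apply_of_mem e (e₀ (f i)) ⟨i, rfl⟩]
  have : (Equiv.ofInjective _ hf').symm ⟨e₀ (f i), ⟨i, rfl⟩⟩ = i :=
    Equiv.ofInjective_symm_apply hf' i
  simp [e, this]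

/-- In the induction the base grows by one, at a cost of `(1 + 1 / (t + j)) ^ j ≤ e`. With `r = t +
j` it says that a uniform bijection on `r` points takes `j` prescribed values with probability at
most `(e / r) ^ j`. -/
lemma factorial_ratio_le (t j : ℕ) :
    ((t + j : ℕ) : ℝ) ^ j * t.factorial ≤ Real.exp 1 ^ j * (t + j).factorial := by
  induction j with
  | zero => simp
  | succ j ih =>
    have hstep : ((t + (j + 1) : ℕ) : ℝ) ^ j ≤ Real.exp 1 * ((t + j : ℕ) : ℝ) ^ j := by
      rcases Nat.eq_zero_or_pos j with rfl | hj
      · simp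
      have hpos : (0 : ℝ) < (t + j : ℕ) := by exact_mod_cast (by omega : 0 < t + j)
      calc ((t + (j + 1) : ℕ) : ℝ) ^ j
          = (1 / ((t + j : ℕ) : ℝ) + 1) ^ j * ((t + j : ℕ) : ℝ) ^ j := by
            rw [← mul_pow]; congr 1; push_cast at hpos ⊢; field_simp; ring
        _ ≤ Real.exp (1 / ((t + j : ℕ) : ℝ)) ^ j * ((t + j : ℕ) : ℝ) ^ j := by
            gcongr; exact Real.add_one_le_exp _
        _ ≤ Real.exp 1 * ((t + j : ℕ) : ℝ) ^ j := by
            rw [← Real.exp_nat_mul]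
            gcongr
            rw [mul_one_div, div_le_one hpos]
            exact_mod_cast (by omega : j ≤ t + j)
    have hf : ((t + (j + 1)).factorial : ℝ) = (t + (j + 1) : ℕ) * (t + j).factorial := by
      rw [← add_assoc, Nat.factorial_succ]; push_cast; ring
    rw [hf, pow_succ, pow_succ]
    calc ((t + (j + 1) : ℕ) : ℝ) ^ j * (t + (j + 1) : ℕ) * t.factorial
        ≤ (Real.exp 1 * ((t + j : ℕ) : ℝ) ^ j) * (t + (j + 1) : ℕ) * t.factorial := by gcongr
      _ = Real.exp 1 * (t + (j + 1) : ℕ) * (((t + j : ℕ) : ℝ) ^ j * t.factorial) := by ring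
      _ ≤ Real.exp 1 * (t + (j + 1) : ℕ) * (Real.exp 1 ^ j * (t + j).factorial) := by gcongr
      _ = _ := by ring

variable [DecidableEq P] [DecidableEq V]

/-- Composing with the inverse of `φ₀` turns these bijections into permutations fixing `D`
pointwise. -/
lemma card_equiv_agree (D : Finset P) (φ₀ : P ≃ V) :
    #{φ : P ≃ V | ∀ s ∈ D, φ s = φ₀ s} = (Fintype.card P - #D).factorial := by
  have e : {φ : P ≃ V // ∀ s ∈ D, φ s = φ₀ s} ≃ Equiv.Perm {s // s ∉ D} :=
    (Equiv.subtypeEquiv (Equiv.equivCongr (Equiv.refl P) φ₀.symm) (fun φ => by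
      refine forall_congr' fun s => ?_
      simp [Equiv.symm_apply_eq])).trans
      (Equiv.Perm.subtypeEquivSubtypePerm (fun s => s ∉ D)).symm
  rw [← Fintype.card_subtype, Fintype.card_congr e, Fintype.card_perm, Fintype.card_subtype_compl,
    Fintype.card_coe]

/-- There are well spread weights on the bijections that send the positions `cpos j` to `x j` and
the positions `pos i` into the large sets `A i`. -/
theorem exists_spread_weights {a c : ℝ} (ha : 0 < a) {M m r : ℕ} (pos : Fin M → P)
    (cpos : Fin m → P) (hpos : Function.Injective (Sum.elim pos cpos)) (x : Fin m → V)
    (hx : Function.Injective x) (A : Fin M → Finset V) (hAx : ∀ i j, x j ∉ A i)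
    (hA : ∀ i, a + M ≤ #(A i)) (hPV : Fintype.card P = Fintype.card V)
    (hr : Fintype.card P = r + (M + m)) (hca : 1 / a ≤ c) (hcr : Real.exp 1 ≤ c * r) :
    ∃ μ : (P ≃ V) → ℝ, (∀ φ, 0 ≤ μ φ) ∧ ∑ φ, μ φ = 1 ∧
      (∀ φ, μ φ ≠ 0 → (∀ j, φ (cpos j) = x j) ∧ ∀ i, φ (pos i) ∈ A i) ∧
      ∀ (D : Finset P) (φ₀ : P ≃ V), (∀ j, cpos j ∉ D) →
        ∑ φ with ∀ s ∈ D, φ s = φ₀ s, μ φ ≤ c ^ #D := by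
  classical
  obtain ⟨w, hw0, hw1, hwsupp, hwm⟩ := exists_sequential_weights ha M A hA
  have hposinj : Function.Injective pos := fun i j h => Sum.inl_injective (hpos (by simpa using h))
  have hcposinj : Function.Injective cpos :=
    fun i j h => Sum.inr_injective (hpos (by simpa using h))
  have hne : ∀ i j, pos i ≠ cpos j := fun i j h => by
    have := @hpos (Sum.inl i) (Sum.inr j) (by simpa using h)
    simp at this
  set K : Finset P := univ.image pos ∪ univ.image cpos with hK
  have hKcard : #K = M + m := by
    rw [hK, card_union_of_disjoint, card_image_of_injective _ hposinj,
      card_image_of_injective _ hcposinj]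
    · simp
    · rw [disjoint_left]
      simp only [mem_image, mem_univ, true_and]
      rintro _ ⟨i, rfl⟩ ⟨j, h⟩
      exact hne i j h.symm
  -- Centres are fixed, the positions `pos i` follow the sequential choice, and the other `r`
  -- positions are filled uniformly.
  set μ : (P ≃ V) → ℝ := fun φ =>
    if ∀ j, φ (cpos j) = x j then w (fun i => φ (pos i)) / r.factorial else 0 with hμ
  have hfac : (0 : ℝ) < r.factorial := by exact_mod_cast r.factorial_pos
  have hc0 : 0 < c := lt_of_lt_of_le (by positivity) hca
  have hr0 : (0 : ℝ) < r := by
    by_contra! h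
    have h1 : c * r ≤ 0 := mul_nonpos_of_nonneg_of_nonpos hc0.le h
    linarith [Real.exp_pos 1]
  have hsum : ∀ (Q : (P ≃ V) → Prop) [DecidablePred Q], ∑ φ with Q φ, μ φ =
      ∑ f, w f * (#{φ : P ≃ V | Q φ ∧ (∀ j, φ (cpos j) = x j) ∧ ∀ i, φ (pos i) = f i} /
        r.factorial) := by
    intro Q _
    rw [← sum_fiberwise _ (fun (φ : P ≃ V) i => φ (pos i))]
    refine sum_congr rfl fun f _ => ?_
    simp only [hμ]
    rw [← sum_filter, filter_filter, filter_filter]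
    rw [sum_congr rfl (g := fun _ => w f / r.factorial)]
    · rw [sum_const, nsmul_eq_mul]
      have : #{φ : P ≃ V | Q φ ∧ (∀ j, φ (cpos j) = x j) ∧ ∀ i, φ (pos i) = f i} =
          #{φ : P ≃ V | Q φ ∧ (fun i => φ (pos i)) = f ∧ ∀ j, φ (cpos j) = x j} := by
        congr 1
        ext φ
        simp only [mem_filter, mem_univ, true_and, funext_iff]
        tauto
      rw [this]; ring
    · intro φ hφ
      rw [mem_filter] at hφ
      rw [hφ.2.2.1]
  refine ⟨μ, fun φ => ?_, ?_, fun φ hφ => ?_, fun D φ₀ hD => ?_⟩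
  · simp only [hμ]
    split_ifs
    · exact div_nonneg (hw0 _) hfac.le
    · exact le_rfl
  · have h := hsum fun _ => True
    simp only [filter_true, true_and] at h
    rw [h, ← hw1]
    refine sum_congr rfl fun f _ => ?_
    by_cases hf : w f = 0
    · rw [hf, zero_mul]
    obtain ⟨hinj, hmem⟩ := hwsupp f hf
    obtain ⟨φ₁, hφ₁⟩ := exists_equiv_extending hPV hpos (g := Sum.elim f x) (by
      rintro (i | i) (j | j) hij
      · exact congrArg _ (hinj (by simpa using hij))
      · have h' : f i = x j := by simpa using hij
        exact absurd (h' ▸ hmem i) (hAx i j)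
      · have h' : x i = f j := by simpa using hij
        exact absurd (h' ▸ hmem j) (hAx j i)
      · exact congrArg _ (hx (by simpa using hij)))
    have hset : ({φ : P ≃ V | (∀ j, φ (cpos j) = x j) ∧ ∀ i, φ (pos i) = f i} : Finset (P ≃ V)) =
        ({φ : P ≃ V | ∀ s ∈ K, φ s = φ₁ s} : Finset (P ≃ V)) := by
      ext φ
      have h1 : ∀ j, φ₁ (cpos j) = x j := fun j => by simpa using hφ₁ (Sum.inr j)
      have h2 : ∀ i, φ₁ (pos i) = f i := fun i => by simpa using hφ₁ (Sum.inl i)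
      simp only [mem_filter, mem_univ, true_and, hK, mem_union, mem_image]
      constructor
      · rintro ⟨h3, h4⟩ s (⟨i, rfl⟩ | ⟨j, rfl⟩)
        · rw [h4, h2]
        · rw [h3, h1]
      · intro h3
        exact ⟨fun j => by rw [h3 _ (Or.inr ⟨j, rfl⟩), h1], fun i => by
          rw [h3 _ (Or.inl ⟨i, rfl⟩), h2]⟩
    rw [hset, card_equiv_agree, hKcard, hr, Nat.add_sub_cancel, div_self hfac.ne', mul_one]
  · simp only [hμ] at hφ
    have h1 : ∀ j, φ (cpos j) = x j := by
      by_contra h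
      exact hφ (if_neg h)
    rw [if_pos h1] at hφ
    have h2 : w (fun i => φ (pos i)) ≠ 0 := fun h => hφ (by rw [h, zero_div])
    exact ⟨h1, (hwsupp _ h2).2⟩
  · rw [hsum]
    set T : Finset (Fin M) := {i | pos i ∈ D} with hT
    set D₀ : Finset P := D \ univ.image pos with hD₀
    -- Indicators of the prescribed values on `D`. Each has average at most `1 / a` over any set of
    -- at least `a` elements, which gives `b`.
    set g : Fin M → V → ℝ := fun i v =>
      if pos i ∈ D then (if v = φ₀ (pos i) then 1 else 0) else 1 with hg
    set b : Fin M → ℝ := fun i => if pos i ∈ D then 1 / a else 1 with hb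
    have hDcard : #D = #T + #D₀ := by
      have h1 : D ∩ univ.image pos = T.image pos := by
        ext s
        simp only [hT, mem_inter, mem_image, mem_univ, true_and, mem_filter]
        constructor
        · rintro ⟨hs, i, rfl⟩
          exact ⟨i, hs, rfl⟩
        · rintro ⟨i, hs, rfl⟩
          exact ⟨hs, i, rfl⟩
      rw [← card_inter_add_card_sdiff D (univ.image pos), h1, card_image_of_injective _ hposinj]
    have hD₀K : Disjoint D₀ K := by
      rw [disjoint_left]
      intro s hs hsK
      rw [hD₀, mem_sdiff] at hs
      rcases mem_union.1 hsK with h | h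
      · exact hs.2 h
      · obtain ⟨j, -, rfl⟩ := mem_image.1 h
        exact hD j hs.1
    have hUcard : #(D₀ ∪ K) = #D₀ + (M + m) := by rw [card_union_of_disjoint hD₀K, hKcard]
    obtain ⟨t, ht⟩ : ∃ t, r = t + #D₀ := by
      have : #(D₀ ∪ K) ≤ Fintype.card P := card_le_univ _
      exact ⟨r - #D₀, by omega⟩
    have hcount : ∀ f : Fin M → V, (#{φ : P ≃ V | (∀ s ∈ D, φ s = φ₀ s) ∧ (∀ j, φ (cpos j) = x j) ∧
        ∀ i, φ (pos i) = f i} : ℝ) ≤ (∏ i, g i (f i)) * t.factorial := by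
      intro f
      rcases ({φ : P ≃ V | (∀ s ∈ D, φ s = φ₀ s) ∧ (∀ j, φ (cpos j) = x j) ∧
        ∀ i, φ (pos i) = f i} : Finset (P ≃ V)).eq_empty_or_nonempty with he | ⟨φ₁, hφ₁⟩
      · rw [he, card_empty, Nat.cast_zero]
        refine mul_nonneg (prod_nonneg fun i _ => ?_) (by positivity)
        simp only [hg]
        split_ifs <;> norm_num
      · simp only [mem_filter, mem_univ, true_and] at hφ₁
        have hprod : ∏ i, g i (f i) = 1 := by
          refine prod_eq_one fun i _ => ?_
          simp only [hg]
          split_ifs with h1 h2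
          · rfl
          · exact absurd (by rw [← hφ₁.2.2 i, hφ₁.1 _ h1]) h2
          · rfl
        rw [hprod, one_mul, Nat.cast_le]
        calc _ ≤ #{φ : P ≃ V | ∀ s ∈ D₀ ∪ K, φ s = φ₁ s} := by
              refine card_le_card fun φ hφ => ?_
              simp only [mem_filter, mem_univ, true_and] at hφ ⊢
              intro s hs
              simp only [hK, mem_union, mem_image, mem_univ, true_and] at hs
              rcases hs with hs | ⟨i, rfl⟩ | ⟨j, rfl⟩
              · have := (mem_sdiff.1 hs).1
                rw [hφ.1 s this, hφ₁.1 s this]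
              · rw [hφ.2.2, hφ₁.2.2]
              · rw [hφ.2.1, hφ₁.2.1]
          _ = t.factorial := by
              rw [card_equiv_agree, hUcard, hr, ht]
              congr 1
              omega
    have hratio : (t.factorial : ℝ) / r.factorial ≤ c ^ #D₀ := by
      rw [div_le_iff₀ hfac]
      have h1 := factorial_ratio_le t #D₀
      rw [← ht] at h1
      have h2 : Real.exp 1 ^ #D₀ ≤ (c * r) ^ #D₀ := by gcongr
      have h3 : (0 : ℝ) < (r : ℝ) ^ #D₀ := by positivity
      refine le_of_mul_le_mul_left (h1.trans ?_) h3
      calc Real.exp 1 ^ #D₀ * r.factorial ≤ (c * r) ^ #D₀ * r.factorial := by gcongr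
        _ = _ := by rw [mul_pow]; ring
    calc _ ≤ ∑ f : Fin M → V, w f * ((∏ i, g i (f i)) * t.factorial / r.factorial) := by
          refine sum_le_sum fun f _ => mul_le_mul_of_nonneg_left ?_ (hw0 f)
          gcongr
          exact hcount f
      _ = (∑ f : Fin M → V, w f * ∏ i, g i (f i)) * ((t.factorial : ℝ) / r.factorial) := by
          rw [sum_mul]
          exact sum_congr rfl fun f _ => by ring
      _ ≤ (∏ i, b i) * ((t.factorial : ℝ) / r.factorial) := by
          refine mul_le_mul_of_nonneg_right (hwm g b ?_ ?_) (by positivity)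
          · intro i v
            simp only [hg]
            split_ifs <;> norm_num
          · intro i S hS
            simp only [hg, hb]
            split_ifs with h
            · rw [sum_ite_eq', one_div, ← div_eq_inv_mul]
              have : (1 : ℝ) ≤ #S / a := by rwa [le_div_iff₀ ha, one_mul]
              split_ifs
              · exact this
              · linarith
            · simp
      _ ≤ c ^ #T * c ^ #D₀ := by
          refine mul_le_mul ?_ hratio (by positivity) (by positivity)
          simp only [hb]
          rw [prod_ite, prod_const, prod_const, one_pow, mul_one]
          gcongr
      _ = c ^ #D := by rw [hDcard, pow_add]

end Counting

end PerturbedGraph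

namespace PerturbedGraph

/-! ### Components of a sparse graph -/

section Components

variable {V : Type*}

/-- A walk from a root to a vertex outside `A` must cross the boundary of `A`. Hence `U` can be
explored from the roots one neighbour at a time. -/
lemma exists_adj_of_reachable {Γ : SimpleGraph V} {R A U : Finset V}
    (hU : ∀ v, v ∈ U ↔ v ∈ Γ.support) (hRA : R ⊆ A) (hAU : A ⊂ U)
    (hreach : ∀ v ∈ U, ∃ r ∈ R, Γ.Reachable r v) :
    ∃ u ∈ A, ∃ v ∈ U, v ∉ A ∧ Γ.Adj u v := by
  obtain ⟨v, hvU, hvA⟩ := exists_of_ssubset hAU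
  obtain ⟨r, hr, ⟨p⟩⟩ := hreach v hvU
  obtain ⟨d, -, h1, h2⟩ := p.exists_boundary_dart (A : Set V) (hRA hr) hvA
  exact ⟨d.fst, h1, d.snd, (hU _).2 ((Γ.mem_support).2 ⟨_, d.adj.symm⟩), h2, d.adj⟩

/-- Representatives `R` of the nontrivial components of a graph that is sparse on every vertex
set; `U` is the set of non-isolated vertices. -/
lemma exists_component_roots (Γ : SimpleGraph V) {κ : ℝ} {U : Finset V} {I : Finset (Sym2 V)}
    (hU : ∀ v, v ∈ U ↔ v ∈ Γ.support) (hI : ∀ e ∈ I, e ∈ Γ.edgeSet)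
    (hdens : ∀ W : Finset V, W.Nonempty → ∀ B : Finset (Sym2 V),
      (∀ e ∈ B, e ∈ Γ.edgeSet ∧ ∀ a ∈ e, a ∈ W) → (#B : ℝ) ≤ κ * (#W - 1)) :
    ∃ R ⊆ U, 2 * #R ≤ #U ∧ (#I : ℝ) ≤ κ * (#U - #R) ∧ ∀ v ∈ U, ∃ r ∈ R, Γ.Reachable r v := by
  classical
  set c := Γ.connectedComponentMk with hc
  set C := U.image c with hC
  have hroot : ∀ K, ∃ u, K ∈ C → u ∈ U ∧ c u = K := by
    intro K
    by_cases hK : K ∈ C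
    · obtain ⟨u, hu, rfl⟩ := mem_image.1 hK
      exact ⟨u, fun _ => ⟨hu, rfl⟩⟩
    · exact ⟨K.nonempty_supp.some, fun h => absurd h hK⟩
  choose root hroot using hroot
  have hRcard : #(C.image root) = #C := card_image_of_injOn fun K hK K' hK' h => by
    rw [← (hroot K hK).2, ← (hroot K' hK').2, h]
  have hUsum : #U = ∑ K ∈ C, #{u ∈ U | c u = K} :=
    card_eq_sum_card_fiberwise fun u hu => mem_image_of_mem c hu
  refine ⟨C.image root, ?_, ?_, ?_, ?_⟩
  · intro u hu
    obtain ⟨K, hK, rfl⟩ := mem_image.1 hu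
    exact (hroot K hK).1
  · rw [hRcard, hUsum, mul_comm, ← smul_eq_mul]
    refine card_nsmul_le_sum _ _ _ fun K hK => ?_
    obtain ⟨u, hu, rfl⟩ := mem_image.1 hK
    obtain ⟨v, huv⟩ := (Γ.mem_support).1 ((hU u).1 hu)
    have hv : v ∈ U := (hU v).2 ((Γ.mem_support).2 ⟨u, huv.symm⟩)
    refine Nat.succ_le_of_lt (one_lt_card.2 ⟨u, by simp [hu], v, ?_, huv.ne⟩)
    simp only [mem_filter, hv, true_and, hc]
    exact SimpleGraph.ConnectedComponent.sound huv.symm.reachable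
  -- An edge is assigned to the component of its chosen end `e.out.1`. The density bound in each
  -- component then sums to `κ` times the number of non-root vertices.
  · have hends : ∀ e ∈ I, ∀ a ∈ e, a ∈ U ∧ c a = c e.out.1 := by
      intro e he a ha
      have he' := hI e he
      have hout : s(e.out.1, e.out.2) = e := by
        rw [← Prod.mk.eta (p := e.out)] ; exact Quot.out_eq e
      rw [← hout, SimpleGraph.mem_edgeSet] at he'
      rw [← hout, Sym2.mem_iff] at ha
      rcases ha with rfl | rfl
      · exact ⟨(hU _).2 ((Γ.mem_support).2 ⟨_, he'⟩), rfl⟩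
      · exact ⟨(hU _).2 ((Γ.mem_support).2 ⟨_, he'.symm⟩),
          SimpleGraph.ConnectedComponent.sound he'.symm.reachable⟩
    have hIsum : #I = ∑ K ∈ C, #{e ∈ I | c e.out.1 = K} :=
      card_eq_sum_card_fiberwise fun e he => by
        exact mem_image_of_mem c (hends e he _ (Sym2.out_fst_mem e)).1
    rw [hRcard, hIsum, hUsum]
    push_cast
    have h1 : ((#C : ℕ) : ℝ) = ∑ K ∈ C, (1 : ℝ) := by simp
    rw [h1, ← sum_sub_distrib, mul_sum]
    refine sum_le_sum fun K hK => hdens _ ?_ _ fun e he => ?_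
    · obtain ⟨u, hu, rfl⟩ := mem_image.1 hK
      exact ⟨u, by simp [hu]⟩
    · rw [mem_filter] at he
      refine ⟨hI e he.1, fun a ha => ?_⟩
      obtain ⟨haU, hac⟩ := hends e he.1 a ha
      exact mem_filter.2 ⟨haU, hac.trans he.2⟩
  · intro v hv
    have hK : c v ∈ C := mem_image_of_mem c hv
    exact ⟨root (c v), mem_image_of_mem _ hK, SimpleGraph.ConnectedComponent.exact (hroot _ hK).2⟩

end Components

/-! ### Counting homomorphisms by exploration -/

section Restriction

variable {V P : Type*} [DecidableEq V]

/-- The restriction of a map to a finite set. -/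
def restrictTo (A : Finset V) (f : V → P) : V → Option P := fun v => if v ∈ A then some (f v) else none

lemma restrictTo_eq_iff {A : Finset V} {f g : V → P} :
    restrictTo A f = restrictTo A g ↔ ∀ v ∈ A, f v = g v := by
  simp only [funext_iff, restrictTo]
  refine forall_congr' fun v => ?_
  by_cases h : v ∈ A <;> simp [h]

variable [Fintype V] [DecidableEq P]

/-- Adding a vertex with few choices increases the number of restrictions by a bounded factor. -/
lemma card_image_restrictTo_insert_le {F : Finset (V → P)} {A : Finset V} {v : V} {D : ℕ}
    (h : ∀ g ∈ F, ∃ N : Finset P, #N ≤ D ∧ ∀ f ∈ F, (∀ x ∈ A, f x = g x) → f v ∈ N) :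
    #(F.image (restrictTo (insert v A))) ≤ D * #(F.image (restrictTo A)) := by
  -- Forgetting the value at `v` maps the new restrictions to the old ones, with fibres of size at
  -- most `D`.
  set cut : (V → Option P) → V → Option P := fun h x => if x ∈ A then h x else none with hcut
  have hcr : ∀ f : V → P, cut (restrictTo (insert v A) f) = restrictTo A f := by
    intro f
    funext x
    by_cases hx : x ∈ A <;> simp [hcut, restrictTo, hx]
  refine card_le_mul_card_image_of_maps_to (f := cut) ?_ D ?_
  · intro h' hh'
    obtain ⟨f, hf, rfl⟩ := mem_image.1 hh'
    rw [hcr]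
    exact mem_image_of_mem _ hf
  · intro b hb
    obtain ⟨g, hg, rfl⟩ := mem_image.1 hb
    obtain ⟨N, hN, hfN⟩ := h g hg
    refine le_trans ?_ hN
    rw [← card_image_of_injective N (Option.some_injective P)]
    refine card_le_card_of_injOn (fun h' => h' v) ?_ ?_
    · intro h' hh'
      simp only [coe_filter, Set.mem_ofPred_eq, mem_image] at hh'
      obtain ⟨⟨f, hf, rfl⟩, hfg⟩ := hh'
      rw [hcr, restrictTo_eq_iff] at hfg
      simp only [restrictTo, mem_insert_self, if_true, coe_image]
      exact ⟨f v, hfN f hf hfg, rfl⟩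
    · intro h₁ hh₁ h₂ hh₂ heq
      simp only [coe_filter, Set.mem_ofPred_eq, mem_image] at hh₁ hh₂
      obtain ⟨⟨f₁, hf₁, rfl⟩, hfg₁⟩ := hh₁
      obtain ⟨⟨f₂, hf₂, rfl⟩, hfg₂⟩ := hh₂
      rw [hcr, restrictTo_eq_iff] at hfg₁ hfg₂
      simp only [restrictTo, mem_insert_self, if_true, Option.some_inj] at heq
      rw [restrictTo_eq_iff]
      intro x hx
      rcases mem_insert.1 hx with rfl | hx
      · exact heq
      · rw [hfg₁ x hx, hfg₂ x hx]

lemma card_image_restrictTo_le [Fintype P] (F : Finset (V → P)) (A : Finset V) :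
    #(F.image (restrictTo A)) ≤ Fintype.card P ^ #A := by
  induction A using Finset.induction_on with
  | empty =>
    rw [card_empty, pow_zero, card_le_one]
    intro a ha b hb
    obtain ⟨f, -, rfl⟩ := mem_image.1 ha
    obtain ⟨g, -, rfl⟩ := mem_image.1 hb
    simp [restrictTo_eq_iff]
  | insert v A hv ih =>
    rw [card_insert_of_notMem hv, pow_succ']
    exact (card_image_restrictTo_insert_le fun g _ =>
      ⟨univ, le_rfl, fun f _ _ => mem_univ _⟩).trans (Nat.mul_le_mul_left _ ih)

/-- The number of homomorphisms from a graph with `#R` nontrivial components to a graph of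
bounded degree. -/
lemma card_image_restrictTo_support_le [Fintype P] {Γ : SimpleGraph V} {Δ : SimpleGraph P}
    {D : ℕ} (hD : ∀ a, ∃ N : Finset P, #N ≤ D ∧ ∀ b, Δ.Adj a b → b ∈ N) {F : Finset (V → P)}
    (hF : ∀ f ∈ F, ∀ u v, Γ.Adj u v → Δ.Adj (f u) (f v)) {R U : Finset V}
    (hU : ∀ v, v ∈ U ↔ v ∈ Γ.support) (hRU : R ⊆ U)
    (hreach : ∀ v ∈ U, ∃ r ∈ R, Γ.Reachable r v) :
    #(F.image (restrictTo U)) ≤ Fintype.card P ^ #R * D ^ (#U - #R) := by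
  have main : ∀ t ≤ #U - #R, ∃ A, R ⊆ A ∧ A ⊆ U ∧ #A = #R + t ∧
      #(F.image (restrictTo A)) ≤ Fintype.card P ^ #R * D ^ t := by
    intro t
    induction t with
    | zero => exact fun _ => ⟨R, Subset.rfl, hRU, rfl, by simpa using card_image_restrictTo_le F R⟩
    | succ t ih =>
      intro ht
      obtain ⟨A, hRA, hAU, hAcard, hA⟩ := ih (by omega)
      have hss : A ⊂ U := ssubset_of_subset_of_ne hAU fun h => by rw [h] at hAcard; omega
      obtain ⟨u, hu, v, hvU, hvA, hadj⟩ := exists_adj_of_reachable hU hRA hss hreach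
      refine ⟨insert v A, hRA.trans (subset_insert _ _), insert_subset hvU hAU, ?_, ?_⟩
      · rw [card_insert_of_notMem hvA, hAcard, add_assoc]
      · rw [pow_succ', ← mul_assoc, mul_comm (_ ^ _) D, mul_assoc]
        refine (card_image_restrictTo_insert_le fun g hg => ?_).trans (Nat.mul_le_mul_left _ hA)
        obtain ⟨N, hN, hNadj⟩ := hD (g u)
        exact ⟨N, hN, fun f hf hfg => hNadj _ (hfg u hu ▸ hF f hf u v hadj)⟩
  obtain ⟨A, hRA, hAU, hAcard, hA⟩ := main _ le_rfl
  have : A = U := eq_of_subset_of_card_le hAU (by have := card_le_card hRU; omega)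
  rwa [this] at hA

end Restriction

/-! ### From vertex spread to edge spread -/

section EdgeSpread

variable {V P : Type*} [Fintype V]

open Classical in
/-- The edge set of the copy of `Δ` placed by the bijection `φ`. -/
noncomputable def placedEdges (Δ : SimpleGraph P) (φ : P ≃ V) : Finset (Sym2 V) :=
  {e | e.map φ.symm ∈ Δ.edgeSet}

lemma mem_placedEdges {Δ : SimpleGraph P} {φ : P ≃ V} {e : Sym2 V} :
    e ∈ placedEdges Δ φ ↔ e.map φ.symm ∈ Δ.edgeSet := by
  simp [placedEdges]

variable [Fintype P] [DecidableEq P] [DecidableEq V]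

/-- Vertex-spread weights on the placements of a sparse graph are edge-spread. -/
theorem sum_placedEdges_le {Δ : SimpleGraph P} {κ c : ℝ} {D : ℕ} {μ : (P ≃ V) → ℝ}
    {S : Finset P} (hκ : 0 < κ) (hc : 1 ≤ c) (hD1 : 1 ≤ D)
    (hcn : D * c ^ 2 ≤ Fintype.card P)
    (hS : ∀ a b, Δ.Adj a b → a ∉ S)
    (hD : ∀ a, ∃ N : Finset P, #N ≤ D ∧ ∀ b, Δ.Adj a b → b ∈ N)
    (hdens : ∀ W : Finset P, W.Nonempty → ∀ B : Finset (Sym2 P),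
      (∀ e ∈ B, e ∈ Δ.edgeSet ∧ ∀ a ∈ e, a ∈ W) → (#B : ℝ) ≤ κ * (#W - 1))
    (hspread : ∀ (Q : Finset P) (φ₀ : P ≃ V), Disjoint Q S →
      ∑ φ : P ≃ V with ∀ s ∈ Q, φ s = φ₀ s, μ φ ≤ (c / Fintype.card P) ^ #Q)
    (hμ : ∀ φ, 0 ≤ μ φ) (I : Finset (Sym2 V)) :
    ∑ φ : P ≃ V with I ⊆ placedEdges Δ φ, μ φ ≤
      ((D * c ^ 2 / Fintype.card P) ^ (1 / κ)) ^ #I := by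
  classical
  set n : ℝ := (Fintype.card P : ℝ) with hn
  have hn0 : 0 < n := lt_of_lt_of_le (by positivity) hcn
  set Φ : Finset (P ≃ V) := {φ | I ⊆ placedEdges Δ φ} with hΦ
  rcases Φ.eq_empty_or_nonempty with he | ⟨φ₀, hφ₀⟩
  · rw [he, sum_empty]; positivity
  have hΦI : ∀ φ ∈ Φ, ∀ e ∈ I, e.map φ.symm ∈ Δ.edgeSet := fun φ hφ e he =>
    mem_placedEdges.1 ((mem_filter.1 hφ).2 he)
  set Γ : SimpleGraph V := SimpleGraph.fromEdgeSet (I : Set (Sym2 V)) with hΓ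
  have hΓhom : ∀ φ ∈ Φ, ∀ u v, Γ.Adj u v → Δ.Adj (φ.symm u) (φ.symm v) := by
    intro φ hφ u v huv
    rw [hΓ, SimpleGraph.fromEdgeSet_adj] at huv
    simpa using hΦI φ hφ _ huv.1
  have hIΓ : ∀ e ∈ I, e ∈ Γ.edgeSet := by
    intro e he
    rw [hΓ, SimpleGraph.edgeSet_fromEdgeSet]
    refine ⟨he, fun hdiag => ?_⟩
    induction e with
    | h x y =>
      have h1 := hΦI φ₀ hφ₀ _ he
      have h2 : x = y := by simpa using hdiag
      subst h2
      simp at h1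
  set U : Finset V := {v | v ∈ Γ.support} with hUdef
  have hU : ∀ v, v ∈ U ↔ v ∈ Γ.support := fun v => by simp [hUdef]
  obtain ⟨R, hRU, h2R, hIcard, hreach⟩ := exists_component_roots Γ (κ := κ) hU hIΓ (by
    intro W hW B hB
    have h := hdens (W.image φ₀.symm) (hW.image _) (B.image (Sym2.map φ₀.symm)) (by
      intro e he
      obtain ⟨e, he', rfl⟩ := mem_image.1 he
      obtain ⟨h1, h2⟩ := hB e he'
      constructor
      · have : e ∈ I := by
          rw [hΓ, SimpleGraph.edgeSet_fromEdgeSet] at h1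
          exact h1.1
        exact hΦI φ₀ hφ₀ e this
      · intro a ha
        obtain ⟨b, hb, rfl⟩ := Sym2.mem_map.1 ha
        exact mem_image_of_mem _ (h2 b hb))
    rwa [card_image_of_injective _ (Sym2.map.injective φ₀.symm.injective),
      card_image_of_injective _ φ₀.symm.injective] at h)
  set F : Finset (V → P) := Φ.image fun φ => (φ.symm : V → P) with hF
  have hcount : #(F.image (restrictTo U)) ≤ Fintype.card P ^ #R * D ^ (#U - #R) :=
    card_image_restrictTo_support_le (Γ := Γ) hD (fun f hf => by
      obtain ⟨φ, hφ, rfl⟩ := mem_image.1 hf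
      exact hΓhom φ hφ) hU hRU hreach
  have hterm : ∀ h ∈ F.image (restrictTo U),
      ∑ φ ∈ Φ with restrictTo U φ.symm = h, μ φ ≤ (c / n) ^ #U := by
    intro h hh
    obtain ⟨f, hf, rfl⟩ := mem_image.1 hh
    obtain ⟨φ₁, hφ₁, rfl⟩ := mem_image.1 hf
    have hQ : Disjoint (U.image φ₁.symm) S := by
      rw [disjoint_left]
      intro s hs
      obtain ⟨u, hu, rfl⟩ := mem_image.1 hs
      obtain ⟨v, huv⟩ := (Γ.mem_support).1 ((hU u).1 hu)
      exact hS _ _ (hΓhom φ₁ hφ₁ u v huv)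
    have h := hspread _ φ₁ hQ
    rw [card_image_of_injective _ φ₁.symm.injective] at h
    refine le_trans (sum_le_sum_of_subset_of_nonneg ?_ fun φ _ _ => hμ φ) h
    intro φ hφ
    obtain ⟨-, hres⟩ := mem_filter.1 hφ
    rw [restrictTo_eq_iff] at hres
    refine mem_filter.2 ⟨mem_univ _, fun s hs => ?_⟩
    obtain ⟨u, hu, rfl⟩ := mem_image.1 hs
    rw [Equiv.apply_symm_apply, ← hres u hu, Equiv.apply_symm_apply]
  obtain ⟨t, ht⟩ : ∃ t, #U = #R + t := ⟨#U - #R, by omega⟩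
  -- Split the placements by where they pull back `U`: the homomorphism count bounds the number of
  -- classes, and vertex spread the mass of each.
  have hsumle : ∑ φ ∈ Φ, μ φ ≤ (#(F.image (restrictTo U)) : ℝ) * (c / n) ^ #U := by
    rw [← sum_fiberwise_of_maps_to (s := Φ) (t := F.image (restrictTo U))
      (g := fun φ => restrictTo U φ.symm)]
    · rw [← nsmul_eq_mul]
      exact sum_le_card_nsmul _ _ _ hterm
    · intro φ hφ
      exact mem_image_of_mem _ (mem_image_of_mem _ hφ)
  have hIt : (#I : ℝ) ≤ κ * t := by
    rw [ht] at hIcard; push_cast at hIcard; simpa using hIcard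
  have hbase0 : 0 < D * c ^ 2 / n := by positivity
  have hbase1 : D * c ^ 2 / n ≤ 1 := by rwa [div_le_one hn0]
  calc ∑ φ ∈ Φ, μ φ ≤ (#(F.image (restrictTo U)) : ℝ) * (c / n) ^ #U := hsumle
    _ ≤ (n ^ #R * D ^ t) * (c / n) ^ #U := by
        have h1 : (#(F.image (restrictTo U)) : ℝ) ≤ n ^ #R * D ^ t := by
          rw [ht, Nat.add_sub_cancel_left] at hcount
          rw [hn]
          exact_mod_cast hcount
        gcongr
    _ = D ^ t * c ^ #U / n ^ t := by
        rw [ht, div_pow, pow_add, pow_add]; field_simp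
    -- Each component has at least two vertices, so `#U ≤ 2 * t` for the number `t` of non-root
    -- vertices.
    _ ≤ D ^ t * c ^ (2 * t) / n ^ t := by
        gcongr
        omega
    _ = (D * c ^ 2 / n) ^ t := by rw [div_pow, mul_pow, pow_mul]
    _ ≤ ((D * c ^ 2 / n) ^ (1 / κ)) ^ #I := by
        generalize D * c ^ 2 / n = y at hbase0 hbase1
        rw [← Real.rpow_natCast, ← Real.rpow_natCast, ← Real.rpow_mul hbase0.le]
        refine Real.rpow_le_rpow_of_exponent_ge hbase0 hbase1 ?_
        rw [one_div, ← div_eq_inv_mul, div_le_iff₀ hκ]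
        linarith

end EdgeSpread

end PerturbedGraph

namespace PerturbedGraph

/-! ### The cycle power on `ZMod n` and on `Fin n` -/

section CyclePower

variable {n : ℕ}

/-- The `k`th power of the cycle on `ZMod n` without the edges at the vertices of `C`. -/
def cyclePowerOff (k : ℕ) (C : Finset (ZMod n)) : SimpleGraph (ZMod n) where
  Adj a b := a ≠ b ∧ a ∉ C ∧ b ∉ C ∧ ∃ j ∈ Icc 1 k, b = a + (j : ℕ) ∨ a = b + (j : ℕ)
  symm := ⟨fun _ _ h => ⟨h.1.symm, h.2.2.1, h.2.1,
    h.2.2.2.imp fun _ hj => ⟨hj.1, hj.2.symm⟩⟩⟩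
  loopless := ⟨fun _ h => h.1 rfl⟩

lemma cyclePowerOff_neighbors (k : ℕ) (C : Finset (ZMod n)) (a : ZMod n) :
    ∃ N : Finset (ZMod n), #N ≤ 2 * k ∧ ∀ b, (cyclePowerOff k C).Adj a b → b ∈ N := by
  refine ⟨(Icc 1 k).image (fun j : ℕ => a + (j : ZMod n)) ∪
    (Icc 1 k).image (fun j : ℕ => a - (j : ZMod n)), ?_, ?_⟩
  · refine (card_union_le _ _).trans ?_
    have h1 : #((Icc 1 k).image (fun j : ℕ => a + (j : ZMod n))) ≤ k :=
      card_image_le.trans (by simp)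
    have h2 : #((Icc 1 k).image (fun j : ℕ => a - (j : ZMod n))) ≤ k :=
      card_image_le.trans (by simp)
    omega
  · rintro b ⟨-, -, -, j, hj, rfl | rfl⟩
    · exact mem_union_left _ (mem_image_of_mem _ hj)
    · exact mem_union_right _ (mem_image.2 ⟨j, hj, by ring⟩)

/-- Charging each edge to the end from which it steps forward reduces this to the forward-degree
bound for `W \ C`. -/
lemma card_cyclePowerOff_edges_le [NeZero n] {k M : ℕ} (hk : 2 ≤ k) {C : Finset (ZMod n)}
    (hC : ∀ x : ZMod n, ∃ i ≤ M, x + (i : ℕ) ∈ C) (hn : 2 * k ^ 2 * (M + 1) < n)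
    {W : Finset (ZMod n)} (hW : W.Nonempty) (B : Finset (Sym2 (ZMod n)))
    (hB : ∀ e ∈ B, e ∈ (cyclePowerOff k C).edgeSet ∧ ∀ a ∈ e, a ∈ W) :
    (#B : ℝ) ≤ ((k : ℝ) - 1 / (2 * k * (M + 1))) * (#W - 1) := by
  have hk' : (2 : ℝ) ≤ k := by exact_mod_cast hk
  have hM : (0 : ℝ) ≤ M := by positivity
  have hκ : (0 : ℝ) ≤ (k : ℝ) - 1 / (2 * k * (M + 1)) := by
    have : 1 / (2 * (k : ℝ) * (M + 1)) ≤ 1 := by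
      rw [div_le_one (by positivity)]; nlinarith
    linarith
  have hsub : B ⊆ (W \ C).biUnion fun w =>
      ({j ∈ Icc 1 k | w + (j : ℕ) ∈ W \ C}).image fun j : ℕ => s(w, w + (j : ZMod n)) := by
    intro e he
    obtain ⟨h1, h2⟩ := hB e he
    induction e with
    | h a b =>
      have ha := h2 a (by simp)
      have hb := h2 b (by simp)
      rw [SimpleGraph.mem_edgeSet] at h1
      obtain ⟨-, haC, hbC, j, hj, rfl | rfl⟩ := h1
      · exact mem_biUnion.2 ⟨a, mem_sdiff.2 ⟨ha, haC⟩,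
          mem_image.2 ⟨j, mem_filter.2 ⟨hj, mem_sdiff.2 ⟨hb, hbC⟩⟩, rfl⟩⟩
      · exact mem_biUnion.2 ⟨b, mem_sdiff.2 ⟨hb, hbC⟩,
          mem_image.2 ⟨j, mem_filter.2 ⟨hj, mem_sdiff.2 ⟨ha, haC⟩⟩, Sym2.eq_swap⟩⟩
  have hcard : #B ≤ ∑ w ∈ W \ C, forwardDegree k (W \ C) w :=
    (card_le_card hsub).trans (card_biUnion_le.trans (sum_le_sum fun w _ => card_image_le))
  have hW1 : (1 : ℝ) ≤ #W := by exact_mod_cast card_pos.2 hW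
  rcases (W \ C).eq_empty_or_nonempty with he | hne
  · rw [he, sum_empty, Nat.le_zero] at hcard
    rw [hcard, Nat.cast_zero]
    exact mul_nonneg hκ (by linarith)
  · calc (#B : ℝ) ≤ ∑ w ∈ W \ C, (forwardDegree k (W \ C) w : ℝ) := by exact_mod_cast hcard
      _ ≤ ((k : ℝ) - 1 / (2 * k * (M + 1))) * (#(W \ C) - 1) :=
          sum_forwardDegree_le hk disjoint_sdiff hC hn hne
      _ ≤ _ := by
          have : (#(W \ C) : ℝ) ≤ #W := by exact_mod_cast card_le_card sdiff_subset
          gcongr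

/-- Each edge of the cycle shifts the residue by `±1`. This turns graph distance at most `k` into a
signed displacement of absolute value at most `k`. -/
lemma natCast_val_eq_add_of_walk {i j : Fin n} (p : (SimpleGraph.cycleGraph n).Walk i j) :
    ∃ d : ℤ, |d| ≤ p.length ∧ ((j.val : ℕ) : ZMod n) = (i.val : ℕ) + (d : ZMod n) := by
  induction p with
  | nil => exact ⟨0, by simp, by simp⟩
  | @cons u v w h p ih =>
    obtain ⟨d, hd, hdj⟩ := ih
    have hstep : ∃ s : ℤ, |s| ≤ 1 ∧ ((v.val : ℕ) : ZMod n) = (u.val : ℕ) + (s : ZMod n) := by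
      match n, u, v, h with
      | 0, u, _, _ => exact u.elim0
      | 1, u, v, h => exact absurd (Subsingleton.elim u v) h.ne
      | m + 2, u, v, h =>
        rw [SimpleGraph.cycleGraph_adj] at h
        have hcast : ∀ t : Fin (m + 2), ((t.val : ℕ) : ZMod (m + 2)) = t :=
          fun t => ZMod.natCast_zmod_val (n := m + 2) t
        rcases h with h | h
        · refine ⟨-1, by simp, ?_⟩
          rw [hcast, hcast]
          have h' : ∀ a b : ZMod (m + 2), a - b = 1 → b = a + ((-1 : ℤ) : ZMod (m + 2)) := by
            intro a b hab
            push_cast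
            rw [← hab]; ring
          exact h' u v h
        · refine ⟨1, by simp, ?_⟩
          rw [hcast, hcast]
          have h' : ∀ a b : ZMod (m + 2), b - a = 1 → b = a + ((1 : ℤ) : ZMod (m + 2)) := by
            intro a b hab
            push_cast
            rw [← hab]; ring
          exact h' u v h
    obtain ⟨s, hs, hsv⟩ := hstep
    refine ⟨s + d, ?_, ?_⟩
    · rw [SimpleGraph.Walk.length_cons]
      push_cast
      have := abs_add_le s d
      omega
    · rw [hdj, hsv]; push_cast; ring

/-- A cyclic arrangement of the vertices in which all steps of length at most `k` are edges gives
the `k`th power of a Hamilton cycle. -/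
lemma containsHamiltonCyclePower_of_arrangement {k : ℕ} {K : SimpleGraph (Fin n)}
    (φ : ZMod n ≃ Fin n)
    (h : ∀ a : ZMod n, ∀ j ∈ Icc 1 k, a ≠ a + (j : ℕ) → K.Adj (φ a) (φ (a + (j : ℕ)))) :
    ContainsHamiltonCyclePower K k := by
  have hinj : Function.Injective fun i : Fin n => φ ((i.val : ℕ) : ZMod n) := by
    intro i j hij
    have h1 := φ.injective hij
    rw [ZMod.natCast_eq_natCast_iff', Nat.mod_eq_of_lt i.2, Nat.mod_eq_of_lt j.2] at h1
    exact Fin.ext h1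
  refine ⟨⟨⟨fun i => φ ((i.val : ℕ) : ZMod n), ?_⟩, hinj⟩⟩
  rintro i j ⟨hne, hdist⟩
  obtain ⟨p, hp⟩ := SimpleGraph.exists_walk_of_edist_ne_top
    (ne_top_of_le_ne_top (ENat.natCast_ne_top k) hdist)
  rw [← hp, Nat.cast_le] at hdist
  obtain ⟨d, hd, hdj⟩ := natCast_val_eq_add_of_walk p
  have hne' : ((i.val : ℕ) : ZMod n) ≠ ((j.val : ℕ) : ZMod n) := fun h' =>
    hne (hinj (congrArg φ h'))
  have hdk : |d| ≤ k := hd.trans (by exact_mod_cast hdist)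
  rcases lt_trichotomy d 0 with hneg | rfl | hpos
  · obtain ⟨t, rfl⟩ : ∃ t : ℕ, d = -t := ⟨(-d).toNat, by omega⟩
    have hij : ((i.val : ℕ) : ZMod n) = (j.val : ℕ) + (t : ℕ) := by rw [hdj]; push_cast; ring
    rw [abs_neg, Nat.abs_cast] at hdk
    have hadj := h (j.val : ℕ) t (mem_Icc.2 ⟨by omega, by omega⟩) (by
      rw [← hij]; exact hne'.symm)
    rw [← hij] at hadj
    exact hadj.symm
  · exact absurd (by simpa using hdj.symm) hne'
  · obtain ⟨t, rfl⟩ : ∃ t : ℕ, d = t := ⟨d.toNat, by omega⟩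
    have hij : ((j.val : ℕ) : ZMod n) = (i.val : ℕ) + (t : ℕ) := by rw [hdj]; push_cast; ring
    rw [Nat.abs_cast] at hdk
    have hadj := h (i.val : ℕ) t (mem_Icc.2 ⟨by omega, by omega⟩) (by
      rw [← hij]; exact hne')
    rwa [← hij] at hadj

end CyclePower

/-! ### Arrangements around centres -/

section Arrangement

/-- In a graph of linear minimum degree there are well spread weights on cyclic arrangements of
the vertices for which all edges of the cycle power at a syndetic set of centers are present. -/
theorem exists_spread_arrangements {n k L : ℕ} [NeZero n] {α : ℝ} (hα : 0 < α)
    (hL : 2 * (2 * k + 1) ≤ L) (hLα : 2 * (2 * k + 1) ≤ α * L) (hLn : L ≤ n)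
    (G : SimpleGraph (Fin n)) [DecidableRel G.Adj] (hG : α * n ≤ G.minDegree) :
    ∃ C : Finset (ZMod n), (∀ x : ZMod n, ∃ i ≤ 2 * L, x + (i : ℕ) ∈ C) ∧
      ∃ μ : (ZMod n ≃ Fin n) → ℝ, (∀ φ, 0 ≤ μ φ) ∧ ∑ φ, μ φ = 1 ∧
        (∀ φ, μ φ ≠ 0 → ∀ W : Finset (Sym2 (Fin n)), placedEdges (cyclePowerOff k C) φ ⊆ W →
          ContainsHamiltonCyclePower (G ⊔ SimpleGraph.fromEdgeSet (W : Set (Sym2 (Fin n)))) k) ∧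
        ∀ (Q : Finset (ZMod n)) (φ₀ : ZMod n ≃ Fin n), Disjoint Q C →
          ∑ φ : ZMod n ≃ Fin n with ∀ s ∈ Q, φ s = φ₀ s, μ φ ≤ ((6 + 2 / α) / n) ^ #Q := by
  classical
  have hL0 : 0 < L := by omega
  have hn0 : 0 < n := by omega
  have hnR : (0 : ℝ) < n := by exact_mod_cast hn0
  set m := n / L with hm
  have hmL : m * L ≤ n := Nat.div_mul_le_self n L
  have hnm : n < (m + 1) * L := by
    rw [mul_comm]; exact Nat.lt_mul_div_succ n hL0
  have hm1 : 1 ≤ m := (Nat.one_le_div_iff hL0).2 hLn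
  have hmn : m ≤ n := Nat.div_le_self n L
  have hlt : ∀ j < m, ∀ o ≤ 2 * k, j * L + o < n := by
    intro j hj o ho
    have : (j + 1) * L ≤ m * L := Nat.mul_le_mul_right L hj
    rw [add_mul] at this
    omega
  have hblock : ∀ j < m, ∀ j' < m, ∀ o ≤ 2 * k, ∀ o' ≤ 2 * k,
      ((j * L + o : ℕ) : ZMod n) = ((j' * L + o' : ℕ) : ZMod n) → j = j' ∧ o = o' := by
    intro j hj j' hj' o ho o' ho' h
    rw [ZMod.natCast_eq_natCast_iff', Nat.mod_eq_of_lt (hlt j hj o ho),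
      Nat.mod_eq_of_lt (hlt j' hj' o' ho')] at h
    have h1 := congrArg (· / L) h
    have h2 := congrArg (· % L) h
    rw [mul_comm j, mul_comm j', Nat.mul_add_div hL0, Nat.mul_add_div hL0,
      Nat.div_eq_of_lt (by omega), Nat.div_eq_of_lt (by omega)] at h1
    rw [mul_comm j, mul_comm j', Nat.mul_add_mod, Nat.mul_add_mod, Nat.mod_eq_of_lt (by omega),
      Nat.mod_eq_of_lt (by omega)] at h2
    exact ⟨by simpa using h1, h2⟩
  set e : Fin (m * (2 * k)) ≃ Fin m × Fin (2 * k) := finProdFinEquiv.symm with he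
  -- Enumerates the offsets `0, …, 2 * k` within a block, skipping the offset `k` of the centre.
  set off : Fin (2 * k) → ℕ := fun t => if t.val < k then t.val else t.val + 1 with hoff
  have hoffle : ∀ t, off t ≤ 2 * k := fun t => by
    have := t.2
    simp only [hoff]; split_ifs <;> omega
  have hoffne : ∀ t, off t ≠ k := fun t => by
    simp only [hoff]; split_ifs <;> omega
  have hoffinj : Function.Injective off := fun t t' h => by
    simp only [hoff] at h
    ext
    split_ifs at h <;> omega
  set pos : Fin (m * (2 * k)) → ZMod n := fun i => (((e i).1.val * L + off (e i).2 : ℕ) : ZMod n)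
    with hpos
  set cpos : Fin m → ZMod n := fun j => ((j.val * L + k : ℕ) : ZMod n) with hcpos
  have hposex : ∀ (j : Fin m) (o : ℕ), o ≤ 2 * k → o ≠ k → ∃ i, (e i).1 = j ∧
      pos i = ((j.val * L + o : ℕ) : ZMod n) := by
    intro j o ho hok
    obtain ⟨t, ht⟩ : ∃ t, off t = o := by
      rcases lt_or_gt_of_ne hok with h | h
      · exact ⟨⟨o, by omega⟩, by simp only [hoff]; rw [if_pos h]⟩
      · exact ⟨⟨o - 1, by omega⟩, by simp only [hoff]; rw [if_neg (by omega)]; omega⟩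
    refine ⟨e.symm (j, t), by simp, ?_⟩
    simp only [hpos, Equiv.apply_symm_apply, ht]
  have hinj : Function.Injective (Sum.elim pos cpos) := by
    rintro (i | i) (j | j) h
    · have h' := hblock _ (e i).1.2 _ (e j).1.2 _ (hoffle _) _ (hoffle _) h
      exact congrArg _ (e.injective (Prod.ext (Fin.ext h'.1) (hoffinj h'.2)))
    · exact absurd (hblock _ (e i).1.2 _ j.2 _ (hoffle _) _ (by omega) h).2 (hoffne _)
    · exact absurd (hblock _ i.2 _ (e j).1.2 _ (by omega) _ (hoffle _) h).2.symm (hoffne _)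
    · exact congrArg _ (Fin.ext (hblock _ i.2 _ j.2 _ (by omega) _ (by omega) h).1)
  set x : Fin m → Fin n := Fin.castLE hmn with hx
  set A : Fin (m * (2 * k)) → Finset (Fin n) := fun i =>
    G.neighborFinset (x (e i).1) \ univ.image x with hA
  have hmLR : (m : ℝ) * L ≤ n := by exact_mod_cast hmL
  have hmα : 2 * (2 * k + 1) * (m : ℝ) ≤ α * n := by
    calc 2 * (2 * k + 1) * (m : ℝ) ≤ (α * L) * m := by gcongr
      _ = α * (m * L) := by ring
      _ ≤ α * n := by gcongr
  have hmn2 : 2 * ((2 * k + 1) * m) ≤ n := by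
    calc 2 * ((2 * k + 1) * m) = m * (2 * (2 * k + 1)) := by ring
      _ ≤ m * L := Nat.mul_le_mul_left m hL
      _ ≤ n := hmL
  obtain ⟨r, hr⟩ : ∃ r, n = r + (m * (2 * k) + m) := ⟨n - (m * (2 * k) + m), by
    have : m * (2 * k) + m = (2 * k + 1) * m := by ring
    omega⟩
  have hrn : (n : ℝ) ≤ 2 * r := by
    have h1 : m * (2 * k) + m = (2 * k + 1) * m := by ring
    exact_mod_cast (by omega : n ≤ 2 * r)
  have hAcard : ∀ i, α * n / 2 + ((m * (2 * k) : ℕ) : ℝ) ≤ #(A i) := by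
    intro i
    have h1 : #(G.neighborFinset (x (e i).1)) - #(univ.image x) ≤ #(A i) := le_card_sdiff _ _
    have h2 : #(univ.image x) ≤ m := by simpa using card_image_le (s := univ) (f := x)
    have h3 : G.minDegree ≤ #(G.neighborFinset (x (e i).1)) := G.minDegree_le_degree _
    have h4 : (G.minDegree : ℝ) ≤ #(A i) + m := by
      exact_mod_cast (by omega : G.minDegree ≤ #(A i) + m)
    push_cast
    linarith
  -- In `6 + 2 / α`, the term `2 / α` is `n / a` for `a = α * n / 2`, and `6` exceeds `2 * e`, which
  -- suffices because `r ≥ n / 2`.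
  obtain ⟨μ, hμ0, hμ1, hμsupp, hμspread⟩ := exists_spread_weights (P := ZMod n) (V := Fin n)
    (a := α * n / 2) (c := (6 + 2 / α) / n) (by positivity) pos cpos hinj x
    (Fin.castLE_injective hmn) A
    (fun i j => by simp [hA]) hAcard (by simp [ZMod.card]) (by rw [ZMod.card]; exact hr)
    (by
      rw [add_div]
      have : 1 / (α * n / 2) = 2 / α / n := by field_simp
      rw [this]
      have : (0 : ℝ) ≤ 6 / n := by positivity
      linarith)
    (by
      have h1 : (6 : ℝ) ≤ 6 + 2 / α := by have : 0 ≤ 2 / α := by positivity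
                                          linarith
      have h2 : (1 : ℝ) / 2 ≤ r / n := by rw [div_le_div_iff₀ (by norm_num) hnR]; linarith
      have h3 := Real.exp_one_lt_d9
      have h4 : (6 + 2 / α) / n * r = (6 + 2 / α) * (r / n) := by ring
      rw [h4]
      nlinarith)
  refine ⟨univ.image cpos, ?_, μ, hμ0, hμ1, ?_, ?_⟩
  · intro y
    have hv : y.val < n := ZMod.val_lt y
    have hy : ((y.val : ℕ) : ZMod n) = y := ZMod.natCast_zmod_val y
    -- The index of the first centre at or after `y`. If it is not below `m`, wrap around to centre
    -- `0`; the incomplete last block is why the gap bound is `2 * L` rather than `L`.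
    set j := (y.val + L - 1 - k) / L with hj
    have hj1 : j * L ≤ y.val + L - 1 - k := Nat.div_mul_le_self _ L
    have hj2 : y.val + L - 1 - k < (j + 1) * L := by
      rw [mul_comm]; exact Nat.lt_mul_div_succ _ hL0
    rw [add_mul] at hj2
    rcases Nat.lt_or_ge j m with hjm | hjm
    · refine ⟨j * L + k - y.val, by omega, mem_image.2 ⟨⟨j, hjm⟩, mem_univ _, ?_⟩⟩
      simp only [hcpos]
      rw [Nat.cast_sub (by omega), hy]
      ring
    · have hge : m * L ≤ j * L := Nat.mul_le_mul_right L hjm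
      rw [add_mul] at hnm
      refine ⟨n + k - y.val, by omega, mem_image.2 ⟨⟨0, hm1⟩, mem_univ _, ?_⟩⟩
      simp only [hcpos]
      rw [Nat.cast_sub (by omega), hy]
      simp
  · intro φ hφ W hW
    obtain ⟨hφc, hφA⟩ := hμsupp φ hφ
    have hadjG : ∀ i, G.Adj (x (e i).1) (φ (pos i)) := fun i => by
      have := (mem_sdiff.1 (hφA i)).1
      rwa [SimpleGraph.mem_neighborFinset] at this
    refine containsHamiltonCyclePower_of_arrangement φ fun a j hj hne => ?_
    rw [mem_Icc] at hj
    rw [SimpleGraph.sup_adj]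
    by_cases ha : a ∈ univ.image cpos
    · obtain ⟨c, -, rfl⟩ := mem_image.1 ha
      obtain ⟨i, hic, hi⟩ := hposex c (k + j) (by omega) (by omega)
      left
      have h1 : cpos c + (j : ℕ) = pos i := by
        rw [hi]; simp only [hcpos]; push_cast; ring
      rw [h1, hφc, ← hic]
      exact hadjG i
    by_cases hb : a + (j : ℕ) ∈ univ.image cpos
    · obtain ⟨c, -, hc⟩ := mem_image.1 hb
      obtain ⟨i, hic, hi⟩ := hposex c (k - j) (by omega) (by omega)
      left
      have h1 : a = pos i := by
        rw [hi, eq_comm, ← sub_eq_iff_eq_add.2 hc]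
        simp only [hcpos]
        push_cast [Nat.cast_sub hj.2]
        ring
      rw [← hc, hφc, ← hic, h1]
      exact (hadjG i).symm
    · right
      rw [SimpleGraph.fromEdgeSet_adj]
      refine ⟨hW (mem_placedEdges.2 ?_), fun h => hne (φ.injective h)⟩
      rw [Sym2.map_mk]
      simp only [Equiv.symm_apply_apply, SimpleGraph.mem_edgeSet]
      exact ⟨hne, ha, hb, j, mem_Icc.2 hj, Or.inl rfl⟩
  · intro Q φ₀ hQ
    exact hμspread Q φ₀ fun j hj => disjoint_left.1 hQ hj (mem_image_of_mem _ (mem_univ _))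

end Arrangement

end PerturbedGraph

/-! ### Choice of parameters and conclusion -/

theorem theorem1p4 (k : ℕ) (hk : 2 ≤ k) (α : ℝ) (hα : 0 < α) :
    ∃ (η : ℝ) (hη : 0 < η), ∀ ε : ℝ, 0 < ε → ∃ N : ℕ, ∀ n : ℕ, N ≤ n →
      ∀ (G : SimpleGraph (Fin n)) [DecidableRel G.Adj], α * (n : ℝ) ≤ (G.minDegree : ℝ) →
        1 - ε ≤ (SimpleGraph.binomialRandom (Fin n) (PerturbedGraph.edgeProb k η hη n)).real
          {H : SimpleGraph (Fin n) | PerturbedGraph.ContainsHamiltonCyclePower (G ⊔ H) k} := by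
  classical
  have hk' : (2 : ℝ) ≤ k := by exact_mod_cast hk
  obtain ⟨L, hL, hLα⟩ : ∃ L : ℕ, 2 * (2 * k + 1) ≤ L ∧ 2 * (2 * (k : ℝ) + 1) ≤ α * L := by
    obtain ⟨L₀, hL₀⟩ := exists_nat_ge (2 * (2 * (k : ℝ) + 1) / α)
    refine ⟨max L₀ (2 * (2 * k + 1)), le_max_right _ _, ?_⟩
    rw [div_le_iff₀ hα] at hL₀
    have : (L₀ : ℝ) ≤ (max L₀ (2 * (2 * k + 1)) : ℕ) := by exact_mod_cast le_max_left _ _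
    nlinarith
  set δ : ℝ := 1 / (2 * k * ((2 * L : ℕ) + 1)) with hδ
  have hδ0 : 0 < δ := by positivity
  have hδ1 : δ ≤ 1 := by
    rw [hδ, div_le_one (by positivity)]
    have : (0 : ℝ) ≤ (2 * L : ℕ) := by positivity
    nlinarith
  set κ : ℝ := k - δ with hκ
  have hκ0 : 0 < κ := by linarith
  set g : ℝ := 1 / κ - 1 / k with hg
  have hg0 : 0 < g := by
    rw [hg, sub_pos]
    exact one_div_lt_one_div_of_lt hκ0 (by linarith)
  set c : ℝ := 6 + 2 / α with hc
  have hc1 : 1 ≤ c := by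
    have : 0 ≤ 2 / α := by positivity
    linarith
  set B : ℝ := (2 * k : ℕ) * c ^ 2 with hB
  have hB0 : 0 < B := by positivity
  -- With `z = n ^ (g / 4)` this gives `z ^ J ≥ n ^ 3`, more than the number of edges of any placed
  -- copy.
  obtain ⟨J, hJ⟩ := exists_nat_ge (12 / g)
  have hJ0 : (0 : ℝ) < J := lt_of_lt_of_le (by positivity) hJ
  have hJg : 3 ≤ g / 4 * J := by
    rw [div_le_iff₀ hg0] at hJ; linarith
  refine ⟨g / 4, by positivity, fun ε hε => ?_⟩
  have hlim : Filter.Tendsto (fun n : ℕ => (n : ℝ) ^ (g / 4)) Filter.atTop Filter.atTop :=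
    (tendsto_rpow_atTop (by positivity)).comp tendsto_natCast_atTop_atTop
  obtain ⟨N, hN⟩ := Filter.eventually_atTop.1 <|
    (hlim.eventually_ge_atTop (Real.exp 1)).and <|
    (hlim.eventually_ge_atTop (J * B ^ (1 / κ))).and <|
    (hlim.eventually_ge_atTop (J * Real.exp 1 / ε)).and <|
    (tendsto_natCast_atTop_atTop.eventually_ge_atTop B).and <|
    (Filter.eventually_ge_atTop L).and <|
    (Filter.eventually_ge_atTop 2).and <|
    Filter.eventually_gt_atTop (2 * k ^ 2 * (2 * L + 1))
  refine ⟨N, fun n hn G _ hG => ?_⟩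
  obtain ⟨hze, hzJ, hzε, hnB, hnL, hn2, hnk⟩ := hN n hn
  have : NeZero n := ⟨by omega⟩
  have hn1 : (1 : ℝ) < n := by exact_mod_cast (by omega : 1 < n)
  have hn0 : (0 : ℝ) < n := by linarith
  set z : ℝ := (n : ℝ) ^ (g / 4) with hz
  have hz0 : 0 < z := by positivity
  obtain ⟨C, hC, μ, hμ0, hμ1, hμsupp, hμspread⟩ :=
    PerturbedGraph.exists_spread_arrangements (k := k) hα hL hLα hnL G hG
  set p : unitInterval := PerturbedGraph.edgeProb k (g / 4) (by positivity) n with hp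
  have hpval : (p : ℝ) = (n : ℝ) ^ (-1 / (k : ℝ) - g / 4) := rfl
  have hp0 : (0 : ℝ) < p := by rw [hpval]; positivity
  have hp1 : (p : ℝ) < 1 := by
    rw [hpval]
    refine Real.rpow_lt_one_of_one_lt_of_neg hn1 ?_
    have : -1 / (k : ℝ) ≤ 0 := div_nonpos_of_nonpos_of_nonneg (by norm_num) (by positivity)
    linarith
  have hJ1 : (1 : ℝ) ≤ J := by exact_mod_cast Nat.cast_pos.1 hJ0
  set E : Finset (Sym2 (Fin n)) := univ.filter fun e => ¬ e.IsDiag with hE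
  set Δ := PerturbedGraph.cyclePowerOff k C with hΔ
  set s : Finset (ZMod n ≃ Fin n) := univ.filter fun φ => μ φ ≠ 0 with hs
  set q : ℝ := (B / n) ^ (1 / κ) with hq
  have hHE : ∀ φ : ZMod n ≃ Fin n, PerturbedGraph.placedEdges Δ φ ⊆ E := by
    intro φ e he
    rw [PerturbedGraph.mem_placedEdges] at he
    rw [hE, mem_filter]
    refine ⟨mem_univ _, fun hd => ?_⟩
    induction e with
    | h a b =>
      have : a = b := by simpa using hd
      subst this
      simp at he
  have hedge : ∀ I : Finset (Sym2 (Fin n)),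
      ∑ φ ∈ s with I ⊆ PerturbedGraph.placedEdges Δ φ, μ φ ≤ q ^ #I := by
    intro I
    have h := PerturbedGraph.sum_placedEdges_le (Δ := Δ) (κ := κ) (c := c) (D := 2 * k) (μ := μ)
      (S := C) hκ0 hc1 (by omega) (by rw [ZMod.card]; exact hnB) (fun a b hab => hab.2.1)
      (PerturbedGraph.cyclePowerOff_neighbors k C)
      (fun W hW B hB => PerturbedGraph.card_cyclePowerOff_edges_le hk hC hnk hW B hB)
      (by simpa only [ZMod.card] using hμspread) hμ0 I
    rw [ZMod.card] at h
    refine le_trans (sum_le_sum_of_subset_of_nonneg ?_ fun φ _ _ => hμ0 φ) h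
    intro φ hφ
    exact mem_filter.2 ⟨mem_univ _, (mem_filter.1 hφ).2⟩
  -- Since `p * n ^ (1 / κ) = n ^ (g - g / 4) = z ^ 3`, one factor `z` is left to absorb the
  -- constant `J * B ^ (1 / κ)`.
  have hqz : q * z ^ 2 ≤ p / J := by
    rw [le_div_iff₀ hJ0, hq, Real.div_rpow hB0.le hn0.le, hpval]
    have h1 : (n : ℝ) ^ (-1 / (k : ℝ) - g / 4) * (n : ℝ) ^ (1 / κ) = z * z ^ 2 := by
      rw [← Real.rpow_add hn0, hz, ← pow_succ', ← Real.rpow_natCast, ← Real.rpow_mul hn0.le]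
      congr 1
      rw [hg]; push_cast; ring
    have h2 : (0 : ℝ) < (n : ℝ) ^ (1 / κ) := by positivity
    rw [div_mul_eq_mul_div, div_mul_eq_mul_div, div_le_iff₀ h2, h1]
    calc B ^ (1 / κ) * z ^ 2 * J = (J * B ^ (1 / κ)) * z ^ 2 := by ring
      _ ≤ z * z ^ 2 := by gcongr
  have hsize : ∀ φ ∈ s, (#(PerturbedGraph.placedEdges Δ φ) : ℝ) < z ^ J := by
    intro φ _
    have h1 : #(PerturbedGraph.placedEdges Δ φ) ≤ n ^ 2 := by
      refine (card_le_card (hHE φ)).trans ?_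
      rw [hE, ← Fintype.card_subtype, Sym2.card_subtype_not_diag, Fintype.card_fin]
      exact Nat.choose_le_pow n 2
    calc (#(PerturbedGraph.placedEdges Δ φ) : ℝ) ≤ (n : ℝ) ^ 2 := by exact_mod_cast h1
      _ < (n : ℝ) ^ 3 := pow_lt_pow_right₀ hn1 (by norm_num)
      _ = (n : ℝ) ^ (3 : ℝ) := by norm_cast
      _ ≤ (n : ℝ) ^ (g / 4 * J) := Real.rpow_le_rpow_of_exponent_le hn1.le hJg
      _ = z ^ J := by rw [hz, Real.rpow_mul hn0.le, Real.rpow_natCast]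
  have hmain := PerturbedGraph.spread_mul_subsetExp_le (E := E) (w := μ) (q := q) (p' := p / J)
    (z := z) (by positivity) (by positivity) (by rw [div_lt_one hJ0]; linarith) hze hqz J s
    (PerturbedGraph.placedEdges Δ) p (fun φ _ => hμ0 φ) (by field_simp; exact le_rfl) hp1.le
    (fun φ _ => hHE φ) hsize hedge
  have hsum : ∑ φ ∈ s, μ φ = 1 := by rw [hs, sum_filter_ne_zero, hμ1]
  rw [hsum, one_mul] at hmain
  have hJz : J * (Real.exp 1 / z) ≤ ε := by
    rw [div_le_iff₀ hε] at hzε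
    rw [← mul_div_assoc, div_le_iff₀ hz0]
    linarith
  have hprob : (SimpleGraph.binomialRandom (Fin n) p).real
      {H | PerturbedGraph.ContainsHamiltonCyclePower (G ⊔ H) k} =
      PerturbedGraph.subsetExp E p fun W => if PerturbedGraph.ContainsHamiltonCyclePower
        (G ⊔ SimpleGraph.fromEdgeSet (W : Set (Sym2 (Fin n)))) k then 1 else 0 := by
    rw [PerturbedGraph.binomialRandom_real_eq_subsetExp]
    congr!
  have hadd := PerturbedGraph.subsetExp_add E (p : ℝ)
    (fun W => if ∃ φ ∈ s, PerturbedGraph.placedEdges Δ φ ⊆ W then 0 else 1)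
    (fun W => if PerturbedGraph.ContainsHamiltonCyclePower
      (G ⊔ SimpleGraph.fromEdgeSet (W : Set (Sym2 (Fin n)))) k then 1 else 0)
  -- For every outcome, either no placed copy of positive weight is captured or the Hamilton cycle
  -- power is present.
  have hone : 1 ≤ PerturbedGraph.subsetExp E (p : ℝ) fun W =>
      (if ∃ φ ∈ s, PerturbedGraph.placedEdges Δ φ ⊆ W then (0 : ℝ) else 1) +
      (if PerturbedGraph.ContainsHamiltonCyclePower
        (G ⊔ SimpleGraph.fromEdgeSet (W : Set (Sym2 (Fin n)))) k then 1 else 0) := by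
    refine (PerturbedGraph.subsetExp_const E (p : ℝ) 1).ge.trans
      (PerturbedGraph.subsetExp_mono hp0.le hp1.le fun W _ => ?_)
    by_cases h : ∃ φ ∈ s, PerturbedGraph.placedEdges Δ φ ⊆ W
    · obtain ⟨φ, hφ, hW⟩ := h
      rw [if_pos (hμsupp φ (mem_filter.1 hφ).2 W hW)]
      split_ifs <;> norm_num
    · rw [if_neg h]
      split_ifs <;> norm_num
  rw [hadd, ← hprob] at hone
  linarith
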